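/- **Setting.** Let $1\le k_u\le u$, $1\le k_s\le s$, $m\ge 0$, $n\ge 1$ be integers and $\sigma>0$. Vectors $x\in\mathbb C^{us}$ consist of $u$ blocks $x_i\in\mathbb C^s$; $x$ is $(a,b)$-sparse if at most $a$ blocks are non-zero and every block has at most $b$ non-zero entries; $\|\cdot\|$ is the Euclidean norm. A matrix $A\in\mathbb C^{m\times us}$ has the hierarchical RIP of order $(a,b)$ with constant $\delta$ if $(1-\delta)\|x\|^2\le\|Ax\|^2\le(1+\delta)\|x\|^2$ for all $(a,b)$-sparse $x$. *Random model.* The channel vector $h\in\mathbb C^{us}$ is generated as follows: the set of active users is a uniformly random $k_u$-element subset of the $u$ users, every user has a uniformly random set of $k_s$ out of $s$ taps, and $h$ has $\mathcal{CN}(0,1)$ entries on the taps of the active users and is $0$ elsewhere, all choices being independent. The observation is $y=Ah+z$, where $A$ is a random $m\times us$ matrix with an arbitrary law, $z\sim\mathcal{CN}(0,\frac{\sigma^2}{n}I_m)$, and $A,h,z$ are independent. Put $\mathrm{SNR}=1/\sigma^2$. *Detector.* HiHTP and HiIHT produce iterates $h^{(0)}=0,h^{(1)},\dots$: the support $\mathcal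 A^{(t+1)}$ is the support of a best $(k_u,k_s)$-sparse approximation to $g=h^{(t)}+A^H(y-Ah^{(t)})$; then $h^{(t+1)}$ is a minimizer of $\|y-Aw\|$ over all $w$ supported in $\mathcal A^{(t+1)}$ (HiHTP), respectively the restriction of $g$ to $\mathcal A^{(t+1)}$ (HiIHT). Ties are broken arbitrarily. The output is $\hbar=h^{(t^*)}$, where the iteration may be stopped at $t^*$ if $h^{(t^*+1)}=h^{(t^*)}$ or if $t^*\ge T$ for a prescribed number $T$. For an energy threshold $\xi\ge0$, user $i$ is detected if $\hbar_i\ne0$ and $\|\hbar_i\|\ge\sqrt\xi$. Let $P_{\mathrm{md}}(\xi)$ be the conditional probability, given that user $i$ is active, that user $i$ is not detected; let $F(x)=\mathbb P(\|h_i\|^2\le x\mid i\text{ active})$; and let $\mathbb P_{\overline{\mathrm{RIP}}}$ be the probability that $A$ does not have the hierarchical RIP of order $(3k_u,3k_s)$ with constant $\delta$. **Theorem.** For every $0\le\delta<1/\sqrt3$ there is a constant $\tau>0$, depending only on $\delta$, such that the following holds for all parameters as above. If $T$ is large enough, depending only on $\delta,u,s,k_u,k_s,m,n,\sigma$ and,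 for (b), on the constant $c$ there, then for both algorithms, every law of $A$, every $\xi\ge0$ and every user $i$: (a) $$P_{\mathrm{md}}(\xi)\le\mathbb P_{\overline{\mathrm{RIP}}}+F(4\xi)+(4\tau^2)^{k_s}\,n^{-k_s}\,\mathrm{SNR}^{-k_s}\,B_1(m,k_s),\qquad B_1(m,k_s)=\sum_{j=0}^{m-1}\frac{\Gamma(k_s+j)}{\Gamma(k_s)\,j!}.$$ (b) (Diversity order $k_s$.) For every $c\ge0$ there is a constant $C$, independent of $\sigma$, $\xi$, $i$, the law of $A$ and the algorithm, such that $P_{\mathrm{md}}(\xi)\le\mathbb P_{\overline{\mathrm{RIP}}}+C\,\mathrm{SNR}^{-k_s}$ whenever $\xi\le c/\mathrm{SNR}$. -/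

import Mathlib

open MeasureTheory ProbabilityTheory
open scoped Matrix

noncomputable section

namespace HiDetect

/-- Compound vectors in `ℂ^{us}`: `u` blocks (users) of `s` entries (channel taps), with the
Euclidean norm. -/
abbrev Vec (u s : ℕ) : Type := EuclideanSpace ℂ (Fin u × Fin s)

/-- Complex `m × us` measurement matrices. -/
abbrev Mat (m u s : ℕ) : Type := Matrix (Fin m) (Fin u × Fin s) ℂ

/-- The entrywise (Borel) σ-algebra on measurement matrices. -/
instance (m u s : ℕ) : MeasurableSpace (Mat m u s) :=
  inferInstanceAs (MeasurableSpace (Fin m → Fin u × Fin s → ℂ))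

/-- The `i`-th block of a compound vector. -/
def block {u s : ℕ} (x : Vec u s) (i : Fin u) : EuclideanSpace ℂ (Fin s) :=
  WithLp.toLp 2 fun j => x (i, j)

/-- The support of a compound vector. -/
def support {u s : ℕ} (x : Vec u s) : Finset (Fin u × Fin s) :=
  open Classical in Finset.univ.filter fun p => x p ≠ 0

/-- The vector that coincides with `x` on `S` and vanishes elsewhere. -/
def restrict {u s : ℕ} (S : Finset (Fin u × Fin s)) (x : Vec u s) : Vec u s :=
  WithLp.toLp 2 fun p => if p ∈ S then x p else 0

/-- Hierarchical `(a, b)`-sparsity: at most `a` blocks are non-zero, and each block has at most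
`b` non-zero entries. -/
def HiSparse {u s : ℕ} (a b : ℕ) (x : Vec u s) : Prop :=
  {i : Fin u | block x i ≠ 0}.ncard ≤ a ∧ ∀ i : Fin u, {j : Fin s | x (i, j) ≠ 0}.ncard ≤ b

/-- `A` has the hierarchical restricted isometry property of order `(a, b)` with constant `δ`
(that is, its hierarchical RIP constant `δ_{a,b}` is at most `δ`). -/
def HiRIP {m u s : ℕ} (a b : ℕ) (δ : ℝ) (A : Mat m u s) : Prop :=
  ∀ x : Vec u s, HiSparse a b x →
    (1 - δ) * ‖x‖ ^ 2 ≤ ‖A.toEuclideanLin x‖ ^ 2 ∧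
      ‖A.toEuclideanLin x‖ ^ 2 ≤ (1 + δ) * ‖x‖ ^ 2

/-! ### The algorithms -/

/-- `S` is a value of the hierarchical thresholding operator at `x`: the support of a best
`(a, b)`-sparse approximation to `x`. The minimizer need not be unique, hence a relation. -/
def IsThreshold {u s : ℕ} (a b : ℕ) (x : Vec u s) (S : Finset (Fin u × Fin s)) : Prop :=
  ∃ w : Vec u s, HiSparse a b w ∧ (∀ w' : Vec u s, HiSparse a b w' → ‖x - w‖ ≤ ‖x - w'‖) ∧
    S = support w

/-- The gradient update `x + Aᴴ (y - A x)`. -/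
def gradStep {m u s : ℕ} (A : Mat m u s) (y : EuclideanSpace ℂ (Fin m)) (x : Vec u s) : Vec u s :=
  x + Aᴴ.toEuclideanLin (y - A.toEuclideanLin x)

/-- The two recovery algorithms. -/
inductive Algorithm
  | HiHTP
  | HiIHT

/-- One iteration `x ↦ x'`. Both algorithms select a support `S` by thresholding the gradient
update. HiHTP then solves the least squares problem over vectors supported in `S`; HiIHT restricts
the gradient update to `S`. -/
def Algorithm.Step (alg : Algorithm) {m u s : ℕ} (ku ks : ℕ) (A : Mat m u s)
    (y : EuclideanSpace ℂ (Fin m)) (x x' : Vec u s) : Prop :=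
  ∃ S : Finset (Fin u × Fin s), IsThreshold ku ks (gradStep A y x) S ∧
    match alg with
    | .HiHTP => support x' ⊆ S ∧ ∀ w : Vec u s, support w ⊆ S →
        ‖y - A.toEuclideanLin x'‖ ≤ ‖y - A.toEuclideanLin w‖
    | .HiIHT => x' = restrict S (gradStep A y x)

/-- `hbar` is an output of the algorithm on input `(A, y)`: an iterate of a run started at `0`,
where the run may be stopped once the iterate has become stationary or once at least `T`
iterations have been performed. -/
def Algorithm.IsOutput (alg : Algorithm) {m u s : ℕ} (ku ks T : ℕ) (A : Mat m u s)
    (y : EuclideanSpace ℂ (Fin m)) (hbar : Vec u s) : Prop :=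
  ∃ x : ℕ → Vec u s, x 0 = 0 ∧ (∀ t, alg.Step ku ks A y (x t) (x (t + 1))) ∧
    ∃ t, hbar = x t ∧ (x (t + 1) = x t ∨ T ≤ t)

/-- The block thresholding operator: the blocks whose `ℓ₂`-norm is at least `√ξ`. -/
def blockThreshold {u s : ℕ} (ξ : ℝ) (x : Vec u s) : Set (Fin u) :=
  {i | √ξ ≤ ‖block x i‖}

/-- The users detected from the output `hbar`: the non-zero blocks that pass the energy threshold
(for `ξ > 0` these are just the blocks that pass the threshold). -/
def detected {u s : ℕ} (ξ : ℝ) (hbar : Vec u s) : Set (Fin u) :=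
  {i | i ∈ blockThreshold ξ hbar ∧ block hbar i ≠ 0}

/-! ### The random model -/

/-- The circularly symmetric complex Gaussian law `CN(0, v)` on `ℂ`, with `E |Z|² = v`. -/
def complexNormal (v : NNReal) : Measure ℂ :=
  ((gaussianReal 0 (v / 2)).prod (gaussianReal 0 (v / 2))).map fun p => (⟨p.1, p.2⟩ : ℂ)

/-- A channel realization: the set of active users, the tap locations of every user, and the
gains. -/
abbrev Channel (u s : ℕ) : Type :=
  Finset (Fin u) × (Fin u → Finset (Fin s)) × (Fin u → Fin s → ℂ)

/-- The user `i` is active. -/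
def activeSet {u s : ℕ} (i : Fin u) : Set (Channel u s) := {c | i ∈ c.1}

/-- The vector of all channel coefficients: the gains on the taps of the active users, and zero
elsewhere. -/
def channelVec {u s : ℕ} (c : Channel u s) : Vec u s :=
  WithLp.toLp 2 fun p => if p.1 ∈ c.1 ∧ p.2 ∈ c.2.1 p.1 then c.2.2 p.1 p.2 else 0

/-- The law of the channel: a uniformly random set of `ku` active users, for each user an
independent uniformly random set of `ks` taps, and independent `CN(0, 1)` gains. -/
def channelLaw (u s ku ks : ℕ) : Measure (Channel u s) :=
  (uniformOn {U : Finset (Fin u) | U.card = ku}).prod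
    ((Measure.pi fun _ : Fin u => uniformOn {S : Finset (Fin s) | S.card = ks}).prod
      (Measure.pi fun _ : Fin u => Measure.pi fun _ : Fin s => complexNormal 1))

/-- The noise law `CN(0, (σ² / n) I_m)`. -/
def noiseLaw (m n : ℕ) (σ : ℝ) : Measure (Fin m → ℂ) :=
  Measure.pi fun _ : Fin m => complexNormal (Real.toNNReal (σ ^ 2 / n))

/-- The joint law of matrix, channel and noise, which are independent. -/
def jointLaw {m u s : ℕ} (μA : Measure (Mat m u s)) (ku ks n : ℕ) (σ : ℝ) :
    Measure (Mat m u s × Channel u s × (Fin m → ℂ)) :=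
  μA.prod ((channelLaw u s ku ks).prod (noiseLaw m n σ))

/-- The measurement vector `y = A h + z`. -/
def observe {m u s : ℕ} (ω : Mat m u s × Channel u s × (Fin m → ℂ)) : EuclideanSpace ℂ (Fin m) :=
  ω.1.toEuclideanLin (channelVec ω.2.1) + WithLp.toLp 2 ω.2.2

/-- The missed-detection probability of user `i`: the conditional probability, given that user
`i` is active, that it is not detected from the output `hbar A y` of the recovery algorithm. -/
def Pmd {m u s : ℕ} (μA : Measure (Mat m u s)) (ku ks n : ℕ) (σ ξ : ℝ)
    (hbar : Mat m u s → EuclideanSpace ℂ (Fin m) → Vec u s) (i : Fin u) : ℝ :=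
  ((jointLaw μA ku ks n σ)[|{ω | ω.2.1 ∈ activeSet i}]).real
    {ω | i ∉ detected ξ (hbar ω.1 (observe ω))}

/-- The probability that the random matrix fails the hierarchical RIP of order `(3 ku, 3 ks)` with
constant `δ`. -/
def PnotRIP {m u s : ℕ} (μA : Measure (Mat m u s)) (ku ks : ℕ) (δ : ℝ) : ℝ :=
  μA.real {A | ¬ HiRIP (3 * ku) (3 * ks) δ A}

/-- The distribution function of the energy `‖h_i‖²` of the block of an active user `i`. -/
def blockCDF {u : ℕ} (s ku ks : ℕ) (i : Fin u) (x : ℝ) : ℝ :=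
  ((channelLaw u s ku ks)[|activeSet i]).real {c | ‖block (channelVec c) i‖ ^ 2 ≤ x}

/-- The signal-to-noise ratio for unit power channel gains. -/
def SNR (σ : ℝ) : ℝ := 1 / σ ^ 2

/-- `B₁(m, k) = ∑_{j < m} Γ(k + j) / (Γ(k) j!)`. -/
def B₁ (m k : ℕ) : ℝ :=
  ∑ j ∈ Finset.range m, Real.Gamma ((k : ℝ) + j) / (Real.Gamma k * (j.factorial : ℝ))

end HiDetect

end

namespace HiDetect

/-! The proof separates a deterministic recovery guarantee from an exponential moment bound.

Deterministic part. On vectors supported in a common sparse set, the RIP makes `Aᴴ A` act like the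
identity up to `δ`. A gradient step from `x` therefore has squared error about `δ² ‖h - x‖²` on the
union of the true and the selected support. Thresholding keeps the most energy, so the energy of `h`
that it misses is at most twice this error, and the error on the selected set contributes at most
once more. The factor `3 δ²` is a contraction precisely for `δ < 1/√3`. Iterating gives `‖h - hbar‖²
≤ r ^ T ‖h‖² + K ‖z‖²` (`Algorithm.Step.error_le`, `exists_recovery_constants`).

Probabilistic part. If the RIP holds and user `i` is missed, then `‖h_i‖² ≤ 4ξ` or `‖h_i‖² ≤ 4 ‖h -
hbar‖²`. The first event gives the term `F(4ξ)`. In the second, the transient is below the noise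
energy for large `T`, up to an event of small probability, which leaves `‖h_i‖² ≤ 4 (K + 1) ‖z‖²`
(`Pmd_le`, `exists_iterations`). Given activity, both energies are independent sums of exponential
variables with explicit Laplace transforms, `k_s` of them in the block and `m` in the noise.
Markov's inequality with the optimal exponent gives the power `k_s` of the noise variance, with a
prefactor comparable to a binomial coefficient, which is `B₁` (`measure_block_le_noise`,
`entropy_le_B₁`). The same method bounds `F(x)` by `e x ^ k_s`, hence the diversity order. -/

/-- A set of positions that meets at most `a` blocks, in at most `b` entries each. -/
def HiSupp {u s : ℕ} (a b : ℕ) (S : Finset (Fin u × Fin s)) : Prop :=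
  (S.image Prod.fst).card ≤ a ∧ ∀ i : Fin u, (S.filter fun p => p.1 = i).card ≤ b

/-! ### Supports and hierarchical thresholding. -/

section Supports

variable {u s : ℕ}

theorem mem_support {x : Vec u s} {p : Fin u × Fin s} : p ∈ support x ↔ x p ≠ 0 := by
  simp [support]

theorem eq_zero_of_support_subset {x : Vec u s} {S : Finset (Fin u × Fin s)}
    (h : support x ⊆ S) {p : Fin u × Fin s} (hp : p ∉ S) : x p = 0 := by
  by_contra hx
  exact hp (h (mem_support.2 hx))

theorem support_subset {x : Vec u s} {S : Finset (Fin u × Fin s)}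
    (h : ∀ p, p ∉ S → x p = 0) : support x ⊆ S := fun p hp => by
  by_contra hx
  exact mem_support.1 hp (h p hx)

theorem block_ne_zero_iff {x : Vec u s} {i : Fin u} :
    block x i ≠ 0 ↔ ∃ j, x (i, j) ≠ 0 := by
  rw [← not_iff_not]
  push Not
  constructor
  · intro h j
    have := congrArg (fun v : EuclideanSpace ℂ (Fin s) => v j) h
    simpa [block] using this
  · intro h
    ext j
    simpa [block] using h j

/-- Sparsity depends on the support only; sets, unlike vectors, can be enlarged and united freely.
-/
theorem hiSparse_iff {a b : ℕ} {x : Vec u s} : HiSparse a b x ↔ HiSupp a b (support x) := by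
  have h1 : {i : Fin u | block x i ≠ 0} = ((support x).image Prod.fst : Finset (Fin u)) := by
    ext i
    simp [block_ne_zero_iff, mem_support]
  have h2 (i : Fin u) : {j : Fin s | x (i, j) ≠ 0}.ncard
      = ((support x).filter fun p => p.1 = i).card := by
    rw [← Set.ncard_coe_finset, ← Set.ncard_image_of_injective _ (Prod.mk_right_injective i)]
    congr 1
    ext ⟨i', j⟩
    simp only [Set.mem_image, Set.mem_ofPred_eq, Prod.mk.injEq, Finset.coe_filter, mem_support]
    constructor
    · rintro ⟨j', hj, rfl, rfl⟩
      exact ⟨hj, rfl⟩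
    · rintro ⟨hj, rfl⟩
      exact ⟨j, hj, rfl, rfl⟩
  simp only [HiSparse, HiSupp, h1, h2, Set.ncard_coe_finset]

theorem HiSupp.mono {a b : ℕ} {S S' : Finset (Fin u × Fin s)} (h : HiSupp a b S) (hS : S' ⊆ S) :
    HiSupp a b S' :=
  ⟨(Finset.card_le_card (Finset.image_subset_image hS)).trans h.1,
    fun i => (Finset.card_le_card (Finset.filter_subset_filter _ hS)).trans (h.2 i)⟩

theorem HiSupp.union {a b a' b' : ℕ} {S S' : Finset (Fin u × Fin s)} (h : HiSupp a b S)
    (h' : HiSupp a' b' S') : HiSupp (a + a') (b + b') (S ∪ S') := by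
  refine ⟨?_, fun i => ?_⟩
  · rw [Finset.image_union]
    exact (Finset.card_union_le _ _).trans (add_le_add h.1 h'.1)
  · rw [Finset.filter_union]
    exact (Finset.card_union_le _ _).trans (add_le_add (h.2 i) (h'.2 i))

/-- The origin of the order `(3 ku, 3 ks)`: one iteration involves the supports of the signal, of
the current iterate and of the thresholded update. -/
theorem HiSupp.union₃ {a b : ℕ} {S₁ S₂ S₃ : Finset (Fin u × Fin s)} (h₁ : HiSupp a b S₁)
    (h₂ : HiSupp a b S₂) (h₃ : HiSupp a b S₃) :
    HiSupp (3 * a) (3 * b) (S₁ ∪ S₂ ∪ S₃) := by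
  have := (h₁.union h₂).union h₃
  rwa [show a + a + a = 3 * a by ring, show b + b + b = 3 * b by ring] at this

theorem support_sub_subset {x y : Vec u s} {S : Finset (Fin u × Fin s)} (hx : support x ⊆ S)
    (hy : support y ⊆ S) : support (x - y) ⊆ S := support_subset fun p hp => by
  simp [eq_zero_of_support_subset hx hp, eq_zero_of_support_subset hy hp]

theorem support_add_subset {x y : Vec u s} {S : Finset (Fin u × Fin s)} (hx : support x ⊆ S)
    (hy : support y ⊆ S) : support (x + y) ⊆ S := support_subset fun p hp => by
  simp [eq_zero_of_support_subset hx hp, eq_zero_of_support_subset hy hp]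

theorem support_smul_subset {x : Vec u s} {S : Finset (Fin u × Fin s)} (c : ℂ)
    (hx : support x ⊆ S) : support (c • x) ⊆ S := support_subset fun p hp => by
  simp [eq_zero_of_support_subset hx hp]

theorem restrict_apply (S : Finset (Fin u × Fin s)) (x : Vec u s) (p : Fin u × Fin s) :
    restrict S x p = if p ∈ S then x p else 0 := rfl

theorem support_restrict_subset (S : Finset (Fin u × Fin s)) (x : Vec u s) :
    support (restrict S x) ⊆ S := support_subset fun p hp => by simp [restrict_apply, hp]

theorem norm_sq_restrict (S : Finset (Fin u × Fin s)) (x : Vec u s) :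
    ‖restrict S x‖ ^ 2 = ∑ p ∈ S, ‖x p‖ ^ 2 := by
  rw [EuclideanSpace.norm_sq_eq, ← Finset.sum_filter_add_sum_filter_not Finset.univ (· ∈ S)]
  rw [Finset.sum_eq_zero (s := Finset.univ.filter (· ∉ S)), add_zero, Finset.filter_mem_eq_inter,
    Finset.univ_inter]
  · exact Finset.sum_congr rfl fun p hp => by simp [restrict_apply, hp]
  · intro p hp
    simp [restrict_apply, (Finset.mem_filter.1 hp).2]

theorem re_inner_restrict_self (S : Finset (Fin u × Fin s)) (x : Vec u s) :
    RCLike.re (inner ℂ (restrict S x) x) = ‖restrict S x‖ ^ 2 := by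
  have : inner ℂ (restrict S x) x = inner ℂ (restrict S x) (restrict S x) := by
    simp only [PiLp.inner_apply]
    refine Finset.sum_congr rfl fun p _ => ?_
    by_cases hp : p ∈ S <;> simp [restrict_apply, hp]
  rw [this, inner_self_eq_norm_sq]

theorem norm_sq_eq_sum_add_sum_compl (S : Finset (Fin u × Fin s)) (x : Vec u s) :
    ‖x‖ ^ 2 = ∑ p ∈ S, ‖x p‖ ^ 2 + ∑ p ∈ Sᶜ, ‖x p‖ ^ 2 := by
  rw [EuclideanSpace.norm_sq_eq, Finset.sum_add_sum_compl]

theorem IsThreshold.hiSupp {a b : ℕ} {g : Vec u s} {S : Finset (Fin u × Fin s)}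
    (h : IsThreshold a b g S) : HiSupp a b S := by
  obtain ⟨w, hw, -, rfl⟩ := h
  exact hiSparse_iff.1 hw

/-- The thresholding operator selects a hierarchically sparse set of maximal energy. -/
theorem IsThreshold.sum_le {a b : ℕ} {g : Vec u s} {S S' : Finset (Fin u × Fin s)}
    (h : IsThreshold a b g S') (hS : HiSupp a b S) :
    ∑ p ∈ S, ‖g p‖ ^ 2 ≤ ∑ p ∈ S', ‖g p‖ ^ 2 := by
  obtain ⟨w, -, hmin, rfl⟩ := h
  have h1 := hmin (restrict S g) (hiSparse_iff.2 (hS.mono (support_restrict_subset S g)))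
  have h2 : ‖g - w‖ ^ 2 ≤ ‖g - restrict S g‖ ^ 2 := by gcongr
  rw [norm_sq_eq_sum_add_sum_compl (support w) (g - w),
    norm_sq_eq_sum_add_sum_compl S (g - restrict S g)] at h2
  have h3 : ∑ p ∈ S, ‖(g - restrict S g) p‖ ^ 2 = 0 :=
    Finset.sum_eq_zero fun p hp => by simp [restrict_apply, hp]
  have h4 : ∑ p ∈ Sᶜ, ‖(g - restrict S g) p‖ ^ 2 = ∑ p ∈ Sᶜ, ‖g p‖ ^ 2 :=
    Finset.sum_congr rfl fun p hp => by simp [restrict_apply, Finset.mem_compl.1 hp]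
  have h5 : ∑ p ∈ (support w)ᶜ, ‖(g - w) p‖ ^ 2 = ∑ p ∈ (support w)ᶜ, ‖g p‖ ^ 2 :=
    Finset.sum_congr rfl fun p hp => by
      simp [eq_zero_of_support_subset subset_rfl (Finset.mem_compl.1 hp)]
  have h6 : 0 ≤ ∑ p ∈ support w, ‖(g - w) p‖ ^ 2 := by positivity
  have h7 := norm_sq_eq_sum_add_sum_compl (support w) g
  have h8 := norm_sq_eq_sum_add_sum_compl S g
  linarith

/-- The energy of a sparse vector missed by the thresholding of a perturbation of it. -/
theorem IsThreshold.sum_sdiff_le {a b : ℕ} {g h : Vec u s} {S S' : Finset (Fin u × Fin s)}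
    (hT : IsThreshold a b g S') (hS : HiSupp a b S) (hh : support h ⊆ S) :
    ∑ p ∈ S \ S', ‖h p‖ ^ 2 ≤
      2 * (∑ p ∈ S \ S', ‖(h - g) p‖ ^ 2 + ∑ p ∈ S' \ S, ‖(h - g) p‖ ^ 2) := by
  have h1 := hT.sum_le hS
  -- The common part `S ∩ S'` cancels: `g` has at most as much energy on `S \ S'` as on `S' \ S`,
  -- where `h` vanishes and `g` is pure error.
  rw [← Finset.sum_sdiff (Finset.inter_subset_left : S ∩ S' ⊆ S),
    ← Finset.sum_sdiff (Finset.inter_subset_right : S ∩ S' ⊆ S'), Finset.sdiff_inter_self_left,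
    Finset.sdiff_inter_self_right] at h1
  have h2 : ∑ p ∈ S' \ S, ‖(h - g) p‖ ^ 2 = ∑ p ∈ S' \ S, ‖g p‖ ^ 2 :=
    Finset.sum_congr rfl fun p hp => by
      simp [eq_zero_of_support_subset hh (Finset.mem_sdiff.1 hp).2]
  have h3 : restrict (S \ S') h = restrict (S \ S') g + restrict (S \ S') (h - g) := by
    ext p
    by_cases hp : p ∈ S \ S' <;> simp [restrict_apply, hp]
  have h4 : ‖restrict (S \ S') h‖ ≤ ‖restrict (S \ S') g‖ + ‖restrict (S \ S') (h - g)‖ := by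
    rw [h3]
    exact norm_add_le _ _
  have h5 : ‖restrict (S \ S') h‖ ^ 2 ≤
      2 * (‖restrict (S \ S') g‖ ^ 2 + ‖restrict (S \ S') (h - g)‖ ^ 2) := by
    nlinarith [norm_nonneg (restrict (S \ S') h),
      sq_nonneg (‖restrict (S \ S') g‖ - ‖restrict (S \ S') (h - g)‖)]
  rw [norm_sq_restrict, norm_sq_restrict, norm_sq_restrict] at h5
  linarith

end Supports

/-! ### Consequences of the RIP for inner products, gradient steps and least squares. -/

section RIP

variable {m u s : ℕ}

theorem inner_conjTranspose (A : Mat m u s) (x : Vec u s) (z : EuclideanSpace ℂ (Fin m)) :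
    inner ℂ x (Aᴴ.toEuclideanLin z) = inner ℂ (A.toEuclideanLin x) z := by
  rw [Matrix.toEuclideanLin_conjTranspose_eq_adjoint, LinearMap.adjoint_inner_right]

/-- Polarization: add the lower RIP bound for `p + q` to the upper one for `p - q`. -/
theorem HiRIP.re_inner_sub_le_half {a b : ℕ} {δ : ℝ} {A : Mat m u s} (hA : HiRIP a b δ A)
    {W : Finset (Fin u × Fin s)} (hW : HiSupp a b W) {p q : Vec u s} (hp : support p ⊆ W)
    (hq : support q ⊆ W) :
    RCLike.re (inner ℂ p q) - RCLike.re (inner ℂ (A.toEuclideanLin p) (A.toEuclideanLin q))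
      ≤ δ * (‖p‖ ^ 2 + ‖q‖ ^ 2) / 2 := by
  have h1 := (hA (p + q) (hiSparse_iff.2 (hW.mono (support_add_subset hp hq)))).1
  have h2 := (hA (p - q) (hiSparse_iff.2 (hW.mono (support_sub_subset hp hq)))).2
  rw [map_add, norm_add_sq (𝕜 := ℂ), norm_add_sq (𝕜 := ℂ)] at h1
  rw [map_sub, norm_sub_sq (𝕜 := ℂ), norm_sub_sq (𝕜 := ℂ)] at h2
  linarith

theorem HiRIP.re_inner_sub_le {a b : ℕ} {δ : ℝ} {A : Mat m u s} (hA : HiRIP a b δ A)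
    {W : Finset (Fin u × Fin s)} (hW : HiSupp a b W) {p q : Vec u s} (hp : support p ⊆ W)
    (hq : support q ⊆ W) :
    RCLike.re (inner ℂ p q) - RCLike.re (inner ℂ (A.toEuclideanLin p) (A.toEuclideanLin q))
      ≤ δ * ‖p‖ * ‖q‖ := by
  rcases eq_or_ne p 0 with rfl | hp0
  · simp
  rcases eq_or_ne q 0 with rfl | hq0
  · simp
  have hp1 : 0 < ‖p‖ := norm_pos_iff.2 hp0
  have hq1 : 0 < ‖q‖ := norm_pos_iff.2 hq0
  -- Rescaled to the common norm `‖p‖ ‖q‖`, the vectors turn the arithmetic mean of squares into a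
  -- product.
  have h := hA.re_inner_sub_le_half hW (support_smul_subset (‖q‖ : ℂ) hp)
    (support_smul_subset (‖p‖ : ℂ) hq)
  simp only [map_smul, inner_smul_left, inner_smul_right, norm_smul, Complex.conj_ofReal,
    Complex.norm_real, norm_norm] at h
  have e (c : ℂ) : RCLike.re ((‖p‖ : ℂ) * ((‖q‖ : ℂ) * c)) = ‖p‖ * ‖q‖ * RCLike.re c := by
    simp [mul_assoc]
  rw [e, e] at h
  refine le_of_mul_le_mul_left ?_ (mul_pos hp1 hq1)
  nlinarith

theorem HiRIP.norm_map_le {a b : ℕ} {δ : ℝ} (hδ : 0 ≤ δ) {A : Mat m u s} (hA : HiRIP a b δ A)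
    {W : Finset (Fin u × Fin s)} (hW : HiSupp a b W) {p : Vec u s} (hp : support p ⊆ W) :
    ‖A.toEuclideanLin p‖ ≤ √(1 + δ) * ‖p‖ := by
  refine (sq_le_sq₀ (norm_nonneg _) (by positivity)).1 ?_
  rw [mul_pow, Real.sq_sqrt (by linarith)]
  exact (hA p (hiSparse_iff.2 (hW.mono hp))).2

theorem re_inner_ge_neg {E : Type*} [NormedAddCommGroup E] [InnerProductSpace ℂ E] (x y : E) :
    -(‖x‖ * ‖y‖) ≤ RCLike.re (inner ℂ x y) := by
  have := re_inner_le_norm (𝕜 := ℂ) (-x) y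
  rw [inner_neg_left, norm_neg, map_neg] at this
  linarith

/-- Energy, on a sparse set, of the error of a gradient step. -/
theorem HiRIP.norm_restrict_error_le {a b : ℕ} {δ : ℝ} (hδ : 0 ≤ δ) {A : Mat m u s}
    (hA : HiRIP a b δ A) {U W : Finset (Fin u × Fin s)} (hW : HiSupp a b W) (hU : U ⊆ W)
    {q : Vec u s} (hq : support q ⊆ W) (z : EuclideanSpace ℂ (Fin m)) :
    ‖restrict U (q - Aᴴ.toEuclideanLin (A.toEuclideanLin q + z))‖
      ≤ δ * ‖q‖ + √(1 + δ) * ‖z‖ := by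
  set v := q - Aᴴ.toEuclideanLin (A.toEuclideanLin q + z) with hv
  have hp : support (restrict U v) ⊆ W := (support_restrict_subset U v).trans hU
  have h1 := re_inner_restrict_self U v
  nth_rewrite 2 [hv] at h1
  -- With `p = restrict U v`, this writes `‖p‖²` as `Re⟨p, q⟩ - Re⟨Ap, Aq⟩ - Re⟨Ap, z⟩`. The RIP and
  -- Cauchy–Schwarz bound it linearly in `‖p‖`, which is then divided out.
  rw [inner_sub_right, inner_conjTranspose, inner_add_right, map_sub, map_add] at h1
  have h2 := hA.re_inner_sub_le hW hp hq
  have h3 := re_inner_ge_neg (A.toEuclideanLin (restrict U v)) z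
  have h4 : ‖A.toEuclideanLin (restrict U v)‖ * ‖z‖ ≤ √(1 + δ) * ‖restrict U v‖ * ‖z‖ := by
    gcongr
    exact hA.norm_map_le hδ hW hp
  rcases (norm_nonneg (restrict U v)).eq_or_lt with h0 | h0
  · rw [← h0]
    positivity
  · refine le_of_mul_le_mul_left ?_ h0
    nlinarith

/-- The residual of a least squares problem makes an obtuse angle with all directions. -/
theorem re_inner_nonpos_of_forall_norm_le {E : Type*} [NormedAddCommGroup E]
    [InnerProductSpace ℂ E] {r v : E} (h : ∀ t : ℝ, 0 < t → ‖r‖ ≤ ‖r - (t : ℂ) • v‖) :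
    RCLike.re (inner ℂ v r) ≤ 0 := by
  have key (t : ℝ) (ht : 0 < t) : 2 * RCLike.re (inner ℂ v r) ≤ t * ‖v‖ ^ 2 := by
    have h1 : ‖r‖ ^ 2 ≤ ‖r - (t : ℂ) • v‖ ^ 2 := by gcongr; exact h t ht
    have e : RCLike.re (inner ℂ r ((t : ℂ) • v)) = t * RCLike.re (inner ℂ v r) := by
      rw [inner_smul_right, inner_re_symm v r]
      simp
    rw [norm_sub_sq (𝕜 := ℂ), e, norm_smul, Complex.norm_real, mul_pow, Real.norm_eq_abs,
      sq_abs] at h1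
    refine le_of_mul_le_mul_left ?_ ht
    nlinarith
  by_contra! hc
  -- The `+ 1` keeps the denominator positive when `v = 0`; this step length already gives `2 Re⟨v,
  -- r⟩ ≤ Re⟨v, r⟩`.
  have h1 := key (RCLike.re (inner ℂ v r) / (‖v‖ ^ 2 + 1)) (by positivity)
  have h2 : RCLike.re (inner ℂ v r) / (‖v‖ ^ 2 + 1) * ‖v‖ ^ 2 ≤ RCLike.re (inner ℂ v r) := by
    rw [div_mul_eq_mul_div, div_le_iff₀ (by positivity)]
    nlinarith
  linarith

/-- First-order optimality in the direction `p = restrict S (h - x)` gives `Re⟨Ap, A(h - x) + z⟩ ≤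
0`. So `‖p‖²` is bounded as for a gradient step, but with the new error `h - x` on the right. -/
theorem norm_restrict_leastSquares_error_le {a b : ℕ} {δ : ℝ} (hδ : 0 ≤ δ) {A : Mat m u s}
    (hA : HiRIP a b δ A) {S W : Finset (Fin u × Fin s)} (hW : HiSupp a b W) (hS : S ⊆ W)
    {h x : Vec u s} (hh : support h ⊆ W) (hx : support x ⊆ S) (z : EuclideanSpace ℂ (Fin m))
    (hmin : ∀ w : Vec u s, support w ⊆ S →
      ‖A.toEuclideanLin h + z - A.toEuclideanLin x‖ ≤
        ‖A.toEuclideanLin h + z - A.toEuclideanLin w‖) :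
    ‖restrict S (h - x)‖ ≤ δ * ‖h - x‖ + √(1 + δ) * ‖z‖ := by
  set p := restrict S (h - x) with hpdef
  have hpS : support p ⊆ S := support_restrict_subset _ _
  have h1 := re_inner_restrict_self S (h - x)
  rw [← hpdef] at h1
  have h2 := hA.re_inner_sub_le hW (hpS.trans hS) (support_sub_subset hh (hx.trans hS))
  have h3 := re_inner_ge_neg (A.toEuclideanLin p) z
  have h4 : ‖A.toEuclideanLin p‖ * ‖z‖ ≤ √(1 + δ) * ‖p‖ * ‖z‖ := by
    gcongr
    exact hA.norm_map_le hδ hW (hpS.trans hS)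
  have h5 : RCLike.re (inner ℂ (A.toEuclideanLin p)
      (A.toEuclideanLin h + z - A.toEuclideanLin x)) ≤ 0 := by
    refine re_inner_nonpos_of_forall_norm_le fun t _ => ?_
    have := hmin (x + (t : ℂ) • p) (support_add_subset hx (support_smul_subset _ hpS))
    rwa [map_add, map_smul, ← sub_sub] at this
  rw [show A.toEuclideanLin h + z - A.toEuclideanLin x = A.toEuclideanLin (h - x) + z by
    rw [map_sub]; abel, inner_add_right, map_add] at h5
  rcases (norm_nonneg p).eq_or_lt with h0 | h0
  · rw [← h0]
    positivity
  · refine le_of_mul_le_mul_left ?_ h0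
    nlinarith

end RIP

/-! ### Contraction of the error and geometric convergence. -/

section Convergence

variable {m u s : ℕ}

theorem Algorithm.Step.hiSupp_support {alg : Algorithm} {ku ks : ℕ} {A : Mat m u s}
    {y : EuclideanSpace ℂ (Fin m)} {x x' : Vec u s} (h : alg.Step ku ks A y x x') :
    HiSupp ku ks (support x') := by
  obtain ⟨S, hS, h⟩ := h
  refine hS.hiSupp.mono ?_
  cases alg
  · exact h.1
  · change x' = _ at h
    rw [h]
    exact support_restrict_subset _ _

/-- Young's inequality with a coefficient of `x ^ 2` arbitrarily close to `1`: splitting off the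
noise then costs nothing in the range of `δ`. -/
theorem add_sq_le_of_pos {ε : ℝ} (hε : 0 < ε) (x y : ℝ) :
    (x + y) ^ 2 ≤ (1 + ε) * x ^ 2 + (1 + 1 / ε) * y ^ 2 := by
  have : (1 + ε) * x ^ 2 + (1 + 1 / ε) * y ^ 2 - (x + y) ^ 2 = (ε * x - y) ^ 2 / ε := by
    field_simp
    ring
  have : 0 ≤ (ε * x - y) ^ 2 / ε := by positivity
  linarith

/-- One iteration of either algorithm contracts the squared error, up to the noise energy. -/
theorem Algorithm.Step.error_le {alg : Algorithm} {ku ks : ℕ} {A : Mat m u s}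
    {h x x' : Vec u s} {z : EuclideanSpace ℂ (Fin m)} {δ ε q : ℝ} (hδ : 0 ≤ δ) (hε : 0 < ε)
    (hq : q = (1 + ε) * δ ^ 2) (hq3 : q < 1 / 3)
    (hA : HiRIP (3 * ku) (3 * ks) δ A) (hh : HiSupp ku ks (support h))
    (hx : HiSupp ku ks (support x))
    (hstep : alg.Step ku ks A (A.toEuclideanLin h + z) x x') :
    ‖h - x'‖ ^ 2 ≤ 3 * q * ‖h - x‖ ^ 2
      + 3 * (1 + 1 / ε) * (1 + δ) / (1 - q) * ‖z‖ ^ 2 := by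
  obtain ⟨S', hS', hstep⟩ := hstep
  set S := support h with hSdef
  set g := gradStep A (A.toEuclideanLin h + z) x with hg
  have hW := hh.union₃ hS'.hiSupp hx
  set W := S ∪ S' ∪ support x with hWdef
  have hSW : S ⊆ W := fun p hp => by simp [hWdef, hp]
  have hSW' : S' ⊆ W := fun p hp => by simp [hWdef, hp]
  have hxW : support x ⊆ W := fun p hp => by simp only [hWdef, Finset.mem_union, hp, or_true]
  have hgq : h - g = (h - x) - Aᴴ.toEuclideanLin (A.toEuclideanLin (h - x) + z) := by
    rw [hg, gradStep, map_sub A.toEuclideanLin,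
      show A.toEuclideanLin h + z - A.toEuclideanLin x
        = A.toEuclideanLin h - A.toEuclideanLin x + z by abel]
    abel
  have hE : ∑ p ∈ S ∪ S', ‖(h - g) p‖ ^ 2 ≤ (δ * ‖h - x‖ + √(1 + δ) * ‖z‖) ^ 2 := by
    rw [← norm_sq_restrict]
    gcongr
    rw [hgq]
    exact hA.norm_restrict_error_le hδ hW (Finset.union_subset hSW hSW')
      (support_sub_subset hSW hxW) z
  have hx'S : support x' ⊆ S' := by
    cases alg
    · exact hstep.1
    · change x' = _ at hstep
      rw [hstep]
      exact support_restrict_subset _ _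
  -- Off `S'` the new iterate vanishes, so the error there is the part of `h` missed by
  -- thresholding.
  have hsplit : ‖h - x'‖ ^ 2 = ∑ p ∈ S', ‖(h - x') p‖ ^ 2 + ∑ p ∈ S \ S', ‖h p‖ ^ 2 := by
    rw [norm_sq_eq_sum_add_sum_compl S']
    congr 1
    rw [← Finset.sum_subset (s₁ := S \ S') (s₂ := S'ᶜ)]
    · refine Finset.sum_congr rfl fun p hp => ?_
      simp [eq_zero_of_support_subset hx'S (Finset.mem_sdiff.1 hp).2]
    · intro p hp
      simp only [Finset.mem_compl]
      exact (Finset.mem_sdiff.1 hp).2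
    · intro p hp hp'
      have hp1 := Finset.mem_compl.1 hp
      have hp2 : p ∉ S := fun h => hp' (Finset.mem_sdiff.2 ⟨h, hp1⟩)
      simp [eq_zero_of_support_subset hx'S hp1, eq_zero_of_support_subset subset_rfl hp2]
  have hmiss := hS'.sum_sdiff_le hh (h := h) subset_rfl
  have hU1 : ∑ p ∈ S ∪ S', ‖(h - g) p‖ ^ 2
      = ∑ p ∈ S \ S', ‖(h - g) p‖ ^ 2 + ∑ p ∈ S', ‖(h - g) p‖ ^ 2 := by
    rw [← Finset.sum_sdiff (Finset.subset_union_right : S' ⊆ S ∪ S'), Finset.union_sdiff_right]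
  have hU2 : ∑ p ∈ S' \ S, ‖(h - g) p‖ ^ 2 ≤ ∑ p ∈ S', ‖(h - g) p‖ ^ 2 :=
    Finset.sum_le_sum_of_subset_of_nonneg Finset.sdiff_subset fun _ _ _ => by positivity
  have hU3 : 0 ≤ ∑ p ∈ S \ S', ‖(h - g) p‖ ^ 2 := by positivity
  have hz : (√(1 + δ) * ‖z‖) ^ 2 = (1 + δ) * ‖z‖ ^ 2 := by
    rw [mul_pow, Real.sq_sqrt (by linarith)]
  have hsq (e : ℝ) : (δ * e + √(1 + δ) * ‖z‖) ^ 2 ≤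
      q * e ^ 2 + (1 + 1 / ε) * (1 + δ) * ‖z‖ ^ 2 := by
    have := add_sq_le_of_pos hε (δ * e) (√(1 + δ) * ‖z‖)
    rw [hz] at this
    rw [hq]
    linarith
  have hq0 : 0 ≤ q := hq ▸ by positivity
  have h1q : 0 < 1 - q := by linarith
  set Z := (1 + 1 / ε) * (1 + δ) * ‖z‖ ^ 2 with hZ
  have hZ0 : 0 ≤ Z := by positivity
  have hgoal : 3 * (1 + 1 / ε) * (1 + δ) / (1 - q) * ‖z‖ ^ 2 = 3 * Z / (1 - q) := by
    rw [hZ]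
    ring
  rw [hgoal]
  have hEx := hsq ‖h - x‖
  -- HiHTP: the least squares bound contains `‖h - x'‖` itself, which is absorbed on the left; the
  -- remaining `2 q` is at most `3 q (1 - q)` since `q < 1/3`. HiIHT: the error on `S'` is the
  -- gradient error, so it and the missed energy add up to three times the bound.
  have key : (1 - q) * ‖h - x'‖ ^ 2 ≤ (1 - q) * (3 * q) * ‖h - x‖ ^ 2 + 3 * Z := by
    cases alg
    · obtain ⟨-, hmin⟩ := hstep
      have hl := norm_restrict_leastSquares_error_le hδ hA hW hSW' hSW hx'S z hmin
      have hl2 : ∑ p ∈ S', ‖(h - x') p‖ ^ 2 ≤ (δ * ‖h - x'‖ + √(1 + δ) * ‖z‖) ^ 2 := by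
        rw [← norm_sq_restrict]
        gcongr
      have hEx' := hsq ‖h - x'‖
      have : 2 * q * ‖h - x‖ ^ 2 ≤ (1 - q) * (3 * q) * ‖h - x‖ ^ 2 := by
        refine mul_le_mul_of_nonneg_right ?_ (by positivity)
        nlinarith
      linarith
    · change x' = _ at hstep
      have hx'g : ∑ p ∈ S', ‖(h - x') p‖ ^ 2 = ∑ p ∈ S', ‖(h - g) p‖ ^ 2 :=
        Finset.sum_congr rfl fun p hp => by
          rw [hstep]
          simp [restrict_apply, hp]
      have h3 : ‖h - x'‖ ^ 2 ≤ 3 * (q * ‖h - x‖ ^ 2 + Z) := by linarith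
      have h4 := mul_le_mul_of_nonneg_left h3 h1q.le
      nlinarith [mul_nonneg hq0 hZ0]
  refine le_of_mul_le_mul_left ?_ h1q
  rw [mul_add, mul_div_cancel₀ _ h1q.ne']
  linarith

/-- Recovery guarantee: geometric convergence to within a multiple of the noise level. -/
theorem exists_recovery_constants {δ : ℝ} (hδ0 : 0 ≤ δ) (hδ : δ < 1 / √3) :
    ∃ r K : ℝ, 0 ≤ r ∧ r < 1 ∧ 0 ≤ K ∧
      ∀ {m u s : ℕ} (ku ks T : ℕ) (alg : Algorithm) (A : Mat m u s) (h hbar : Vec u s)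
        (z : EuclideanSpace ℂ (Fin m)), HiRIP (3 * ku) (3 * ks) δ A →
        HiSupp ku ks (support h) → alg.IsOutput ku ks T A (A.toEuclideanLin h + z) hbar →
        ‖h - hbar‖ ^ 2 ≤ r ^ T * ‖h‖ ^ 2 + K * ‖z‖ ^ 2 := by
  have hδ2 : δ ^ 2 < 1 / 3 := by
    have : δ ^ 2 < (1 / √3) ^ 2 := by gcongr
    rwa [div_pow, Real.sq_sqrt (by norm_num), one_pow] at this
  -- With `d = δ²`, this choice gives `1/3 - q = (1/3 - d) (1 - d) > 0`.
  set ε := 1 / 3 - δ ^ 2 with hε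
  have hε0 : 0 < ε := by linarith
  set q := (1 + ε) * δ ^ 2 with hq
  have hq0 : 0 ≤ q := by positivity
  have hq3 : q < 1 / 3 := by nlinarith
  set K₀ := 3 * (1 + 1 / ε) * (1 + δ) / (1 - q) with hK₀
  have hK₀0 : 0 ≤ K₀ := div_nonneg (by positivity) (by linarith)
  have h1r : 0 < 1 - 3 * q := by linarith
  -- The second constant is the fixed point of the recursion `e ↦ 3 q e + K₀` for the squared error
  -- in units of `‖z‖²`.
  refine ⟨3 * q, K₀ / (1 - 3 * q), by positivity, by linarith, by positivity, ?_⟩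
  rintro m u s ku ks T alg A h hbar z hA hh ⟨x, hx0, hstep, t, rfl, ht⟩
  have hxs (t : ℕ) : HiSupp ku ks (support (x t)) := by
    cases t with
    | zero =>
      rw [hx0]
      have : support (0 : Vec u s) = ∅ := by simp [support]
      simp [this, HiSupp]
    | succ t => exact (hstep t).hiSupp_support
  have hrec (t : ℕ) : ‖h - x (t + 1)‖ ^ 2 ≤ 3 * q * ‖h - x t‖ ^ 2 + K₀ * ‖z‖ ^ 2 :=
    (hstep t).error_le hδ0 hε0 hq hq3 hA hh (hxs t)
  set N := K₀ / (1 - 3 * q) * ‖z‖ ^ 2 with hN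
  have hN0 : 0 ≤ N := by positivity
  have hNK : K₀ * ‖z‖ ^ 2 = (1 - 3 * q) * N := by
    rw [hN]
    field_simp
  rcases ht with ht | ht
  -- At a stationary iterate the recursion bounds the error by itself, so no transient is left.
  · have h1 := hrec t
    rw [ht, hNK] at h1
    have : ‖h - x t‖ ^ 2 ≤ N := le_of_mul_le_mul_left (by linarith) h1r
    have : 0 ≤ (3 * q) ^ T * ‖h‖ ^ 2 := by positivity
    linarith
  · have hind : ∀ t, ‖h - x t‖ ^ 2 ≤ (3 * q) ^ t * ‖h‖ ^ 2 + N := by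
      intro t
      induction t with
      | zero => simpa [hx0] using hN0
      | succ t ih =>
        have h1 := hrec t
        rw [hNK] at h1
        have h2 := mul_le_mul_of_nonneg_left ih (by positivity : 0 ≤ 3 * q)
        rw [pow_succ (3 * q)]
        linarith
    refine (hind t).trans ?_
    gcongr ?_ * _ + _
    exact pow_le_pow_of_le_one (by positivity) (by linarith) ht

end Convergence

/-! ### Exponential moments of complex Gaussian vectors. -/

section Gaussian

theorem lintegral_exp_mul_sq_gaussianReal {v : NNReal} (hv : v ≠ 0) {t : ℝ}
    (ht : 2 * t * v < 1) :
    ∫⁻ x, ENNReal.ofReal (Real.exp (t * x ^ 2)) ∂(gaussianReal 0 v)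
      = ENNReal.ofReal (√(1 - 2 * t * v))⁻¹ := by
  have hv0 : (0 : ℝ) < v := NNReal.coe_pos.2 (pos_iff_ne_zero.2 hv)
  have hb : 0 < (1 - 2 * t * v) / (2 * v) := div_pos (by linarith) (by positivity)
  rw [gaussianReal_of_var_ne_zero _ hv, lintegral_withDensity_eq_lintegral_mul _
    (measurable_gaussianPDF 0 v) (by fun_prop)]
  have h1 (x : ℝ) : (gaussianPDF 0 v * fun x => ENNReal.ofReal (Real.exp (t * x ^ 2))) x
      = ENNReal.ofReal ((√(2 * Real.pi * v))⁻¹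
        * Real.exp (-((1 - 2 * t * v) / (2 * v)) * x ^ 2)) := by
    rw [Pi.mul_apply, gaussianPDF, ← ENNReal.ofReal_mul (gaussianPDFReal_nonneg _ _ _),
      gaussianPDFReal, mul_assoc, ← Real.exp_add]
    congr 3
    field_simp
    ring
  simp_rw [h1]
  rw [← ofReal_integral_eq_lintegral_ofReal ((integrable_exp_neg_mul_sq hb).const_mul _)
    (.of_forall fun x => by positivity), integral_const_mul, integral_gaussian]
  congr 1
  rw [← Real.sqrt_inv, ← Real.sqrt_inv, ← Real.sqrt_mul (by positivity)]
  congr 1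
  have := Real.pi_pos
  have : 1 - 2 * t * v ≠ 0 := by linarith
  field_simp

theorem measurable_complex_mk : Measurable fun p : ℝ × ℝ => (⟨p.1, p.2⟩ : ℂ) :=
  Complex.measurableEquivRealProd.symm.measurable

instance (v : NNReal) : IsProbabilityMeasure (complexNormal v) :=
  Measure.isProbabilityMeasure_map measurable_complex_mk.aemeasurable

/-- Real and imaginary part each contribute `(1 - t v) ^ (-1/2)`. Negative `t` serves the block
energy, positive `t` the noise energy. -/
theorem lintegral_exp_mul_normSq_complexNormal {v : NNReal} (hv : v ≠ 0) {t : ℝ}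
    (ht : t * v < 1) :
    ∫⁻ w, ENNReal.ofReal (Real.exp (t * ‖w‖ ^ 2)) ∂(complexNormal v)
      = ENNReal.ofReal (1 - t * v)⁻¹ := by
  have hv2 : v / 2 ≠ 0 := by positivity
  have e : 2 * t * ((v / 2 : NNReal) : ℝ) = t * v := by
    push_cast
    ring
  have h1 (p : ℝ × ℝ) : ENNReal.ofReal (Real.exp (t * ‖(⟨p.1, p.2⟩ : ℂ)‖ ^ 2))
      = ENNReal.ofReal (Real.exp (t * p.1 ^ 2)) * ENNReal.ofReal (Real.exp (t * p.2 ^ 2)) := by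
    rw [← ENNReal.ofReal_mul (Real.exp_nonneg _), ← Real.exp_add, Complex.sq_norm,
      Complex.normSq_mk]
    congr 2
    ring
  rw [complexNormal, lintegral_map (by fun_prop) measurable_complex_mk]
  simp_rw [h1]
  rw [lintegral_prod_mul (f := fun x => ENNReal.ofReal (Real.exp (t * x ^ 2)))
    (g := fun x => ENNReal.ofReal (Real.exp (t * x ^ 2))) (by fun_prop) (by fun_prop),
    lintegral_exp_mul_sq_gaussianReal hv2
    (by rwa [e]), e, ← ENNReal.ofReal_mul (by positivity), ← mul_inv, Real.mul_self_sqrt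
    (by linarith)]

theorem complexNormal_singleton_zero {v : NNReal} (hv : v ≠ 0) : complexNormal v {0} = 0 := by
  have hv2 : v / 2 ≠ 0 := by positivity
  have := nullSingletonClass_gaussianReal (μ := 0) hv2
  rw [complexNormal, Measure.map_apply measurable_complex_mk (measurableSet_singleton _)]
  refine measure_mono_null (t := {0} ×ˢ Set.univ) ?_ ?_
  · rintro ⟨x, y⟩ h
    have : (⟨x, y⟩ : ℂ) = 0 := h
    simpa using congrArg Complex.re this
  · rw [Measure.prod_prod, measure_singleton, zero_mul]

theorem lintegral_pi_prod_eq_pow {ι α : Type*} [Fintype ι] [MeasurableSpace α] (μ : Measure α)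
    [IsProbabilityMeasure μ] {f : α → ENNReal} (hf : Measurable f) (S : Finset ι) :
    ∫⁻ x : ι → α, ∏ j ∈ S, f (x j) ∂(Measure.pi fun _ => μ) = (∫⁻ a, f a ∂μ) ^ S.card := by
  rw [lintegral_prod_eq_prod_lintegral_of_indepFun S (fun j (x : ι → α) => f (x j))
    (iIndepFun_pi (X := fun _ => f) fun _ => hf.aemeasurable)
    fun i => hf.comp (measurable_pi_apply i)]
  refine Finset.prod_eq_pow_card fun j _ => ?_
  exact (measurePreserving_eval (fun _ : ι => μ) j).lintegral_comp hf

theorem lintegral_exp_mul_sum_normSq {ι : Type*} [Fintype ι] {v : NNReal} (hv : v ≠ 0) {t : ℝ}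
    (ht : t * v < 1) (S : Finset ι) :
    ∫⁻ x : ι → ℂ, ENNReal.ofReal (Real.exp (t * ∑ j ∈ S, ‖x j‖ ^ 2))
        ∂(Measure.pi fun _ => complexNormal v)
      = ENNReal.ofReal ((1 - t * v)⁻¹ ^ S.card) := by
  have h1 (x : ι → ℂ) : ENNReal.ofReal (Real.exp (t * ∑ j ∈ S, ‖x j‖ ^ 2))
      = ∏ j ∈ S, ENNReal.ofReal (Real.exp (t * ‖x j‖ ^ 2)) := by
    rw [Finset.mul_sum, Real.exp_sum, ENNReal.ofReal_prod_of_nonneg fun _ _ => Real.exp_nonneg _]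
  simp_rw [h1]
  rw [lintegral_pi_prod_eq_pow (complexNormal v)
    (f := fun w => ENNReal.ofReal (Real.exp (t * ‖w‖ ^ 2))) (by fun_prop) S,
    lintegral_exp_mul_normSq_complexNormal hv ht, ENNReal.ofReal_pow]
  exact inv_nonneg.2 (by linarith)

end Gaussian

/-! ### The channel law and the energy of an active block. -/

section Channel

variable {u s ku ks : ℕ}

theorem measurableSet_activeSet (i : Fin u) : MeasurableSet (activeSet i : Set (Channel u s)) :=
  measurableSet_mem_finset i |>.preimage measurable_fst

theorem measurable_channelVec_apply (p : Fin u × Fin s) :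
    Measurable fun c : Channel u s => channelVec c p := by
  have h : MeasurableSet {c : Channel u s | p.1 ∈ c.1 ∧ p.2 ∈ c.2.1 p.1} := by
    refine (measurableSet_activeSet p.1).inter ?_
    exact (measurableSet_mem_finset p.2).preimage
      ((measurable_pi_apply p.1).comp (measurable_fst.comp measurable_snd))
  exact Measurable.ite h (by fun_prop) measurable_const

theorem normSq_block_channelVec {c : Channel u s} {i : Fin u} (hi : c ∈ activeSet i) :
    ‖block (channelVec c) i‖ ^ 2 = ∑ j ∈ c.2.1 i, ‖c.2.2 i j‖ ^ 2 := by
  have hi' : i ∈ c.1 := hi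
  rw [EuclideanSpace.norm_sq_eq, ← Finset.sum_subset (Finset.subset_univ (c.2.1 i))]
  · refine Finset.sum_congr rfl fun j hj => ?_
    simp [block, channelVec, hi', hj]
  · intro j _ hj
    simp [block, channelVec, hj]

theorem measurable_normSq_block_channelVec (i : Fin u) :
    Measurable fun c : Channel u s => ‖block (channelVec c) i‖ ^ 2 := by
  simp_rw [EuclideanSpace.norm_sq_eq]
  exact Finset.measurable_sum _ fun j _ => (measurable_channelVec_apply (i, j)).norm.pow_const 2

theorem measurable_normSq_channelVec :
    Measurable fun c : Channel u s => ‖channelVec c‖ ^ 2 := by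
  simp_rw [EuclideanSpace.norm_sq_eq]
  exact Finset.measurable_sum _ fun p _ => (measurable_channelVec_apply p).norm.pow_const 2

theorem isProbabilityMeasure_uniformOn_card {k l : ℕ} (h : k ≤ l) :
    IsProbabilityMeasure (uniformOn {U : Finset (Fin l) | U.card = k}) := by
  refine isProbabilityMeasure_uniformOn (Set.toFinite _) ?_
  obtain ⟨t, -, ht⟩ := Finset.exists_subset_card_eq
    (s := (Finset.univ : Finset (Fin l))) (n := k) (by simpa using h)
  exact ⟨t, ht⟩

theorem isProbabilityMeasure_channelLaw (hu : ku ≤ u) (hs : ks ≤ s) :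
    IsProbabilityMeasure (channelLaw u s ku ks) := by
  have := isProbabilityMeasure_uniformOn_card hu
  have := isProbabilityMeasure_uniformOn_card hs
  unfold channelLaw
  infer_instance

theorem ae_card_uniformOn (k l : ℕ) :
    ∀ᵐ U ∂(uniformOn {U : Finset (Fin l) | U.card = k}), U.card = k :=
  ae_cond_mem (Set.toFinite _).measurableSet

theorem ae_card_taps (hs : ks ≤ s) :
    ∀ᵐ S ∂(Measure.pi fun _ : Fin u => uniformOn {S : Finset (Fin s) | S.card = ks}),
      ∀ i, (S i).card = ks := by
  have := isProbabilityMeasure_uniformOn_card hs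
  rw [ae_all_iff]
  intro i
  exact (measurePreserving_eval (fun _ : Fin u => uniformOn {S : Finset (Fin s) | S.card = ks})
    i).quasiMeasurePreserving.ae (ae_card_uniformOn ks s)

theorem ae_hiSupp_channelVec (hu : ku ≤ u) (hs : ks ≤ s) :
    ∀ᵐ c ∂(channelLaw u s ku ks), HiSupp ku ks (support (channelVec c)) := by
  have := isProbabilityMeasure_uniformOn_card hu
  have := isProbabilityMeasure_uniformOn_card hs
  have h1 : ∀ᵐ c ∂(channelLaw u s ku ks), c.1.card = ku :=
    Measure.quasiMeasurePreserving_fst.ae (ae_card_uniformOn ku u)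
  have h2 : ∀ᵐ c ∂(channelLaw u s ku ks), ∀ i, (c.2.1 i).card = ks :=
    (Measure.quasiMeasurePreserving_fst.comp Measure.quasiMeasurePreserving_snd).ae
      (ae_card_taps hs)
  filter_upwards [h1, h2] with c hc1 hc2
  have hmem (p : Fin u × Fin s) (hp : p ∈ support (channelVec c)) :
      p.1 ∈ c.1 ∧ p.2 ∈ c.2.1 p.1 := by
    by_contra hc
    exact mem_support.1 hp (if_neg hc)
  refine ⟨hc1 ▸ Finset.card_le_card ?_, fun i => ?_⟩
  · intro i hi
    obtain ⟨p, hp, rfl⟩ := Finset.mem_image.1 hi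
    exact (hmem p hp).1
  · rw [← hc2 i]
    refine Finset.card_le_card_of_injOn Prod.snd (fun p hp => ?_) ?_
    · obtain ⟨hp', rfl⟩ := Finset.mem_filter.1 hp
      exact (hmem p hp').2
    · intro p hp p' hp' h
      have e1 := (Finset.mem_filter.1 hp).2
      have e2 := (Finset.mem_filter.1 hp').2
      exact Prod.ext (e1.trans e2.symm) h

/-- Laplace transform of the energy of an active block. -/
theorem lintegral_exp_neg_block (hu : ku ≤ u) (hs : ks ≤ s) (i : Fin u) {t : ℝ} (ht : 0 ≤ t) :
    ∫⁻ c in activeSet i, ENNReal.ofReal (Real.exp (-t * ‖block (channelVec c) i‖ ^ 2))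
        ∂(channelLaw u s ku ks)
      = channelLaw u s ku ks (activeSet i) * ENNReal.ofReal ((1 + t)⁻¹ ^ ks) := by
  have := isProbabilityMeasure_uniformOn_card hu
  have := isProbabilityMeasure_uniformOn_card hs
  -- Given activity of `i`, the block energy depends on taps and gains only, so the activity event
  -- splits off as an independent factor.
  rw [setLIntegral_congr_fun (g := fun c => ENNReal.ofReal
    (Real.exp (-t * ∑ j, if j ∈ c.2.1 i then ‖c.2.2 i j‖ ^ 2 else 0)))
    (measurableSet_activeSet i) fun c hc => by
      simp only
      rw [normSq_block_channelVec hc, Finset.sum_ite_mem, Finset.univ_inter]]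
  have hact : (activeSet i : Set (Channel u s)) = {U | i ∈ U} ×ˢ Set.univ := by
    ext c
    simp [activeSet]
  set P₂ := (Measure.pi fun _ : Fin u => uniformOn {S : Finset (Fin s) | S.card = ks}).prod
      (Measure.pi fun _ : Fin u => Measure.pi fun _ : Fin s => complexNormal 1) with hP₂
  have hmeas : Measurable fun d : (Fin u → Finset (Fin s)) × (Fin u → Fin s → ℂ) =>
      ENNReal.ofReal (Real.exp (-t * ∑ j, if j ∈ d.1 i then ‖d.2 i j‖ ^ 2 else 0)) := by
    refine ENNReal.measurable_ofReal.comp (Real.measurable_exp.comp (Measurable.const_mul ?_ _))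
    refine Finset.measurable_sum _ fun j _ => Measurable.ite ?_ (by fun_prop) measurable_const
    exact (measurableSet_mem_finset j).preimage ((measurable_pi_apply i).comp measurable_fst)
  have hinner : ∫⁻ d, ENNReal.ofReal (Real.exp (-t * ∑ j, if j ∈ d.1 i then ‖d.2 i j‖ ^ 2 else 0))
      ∂P₂ = ENNReal.ofReal ((1 + t)⁻¹ ^ ks) := by
    rw [hP₂, lintegral_prod _ hmeas.aemeasurable]
    have : ∀ᵐ S ∂(Measure.pi fun _ : Fin u => uniformOn {S : Finset (Fin s) | S.card = ks}),
        ∫⁻ g : Fin u → Fin s → ℂ, ENNReal.ofReal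
          (Real.exp (-t * ∑ j, if j ∈ S i then ‖g i j‖ ^ 2 else 0))
          ∂(Measure.pi fun _ : Fin u => Measure.pi fun _ : Fin s => complexNormal 1)
        = ENNReal.ofReal ((1 + t)⁻¹ ^ ks) := by
      filter_upwards [ae_card_taps hs] with S hS
      simp_rw [Finset.sum_ite_mem, Finset.univ_inter]
      rw [(measurePreserving_eval (fun _ : Fin u => Measure.pi fun _ : Fin s => complexNormal 1)
        i).lintegral_comp (f := fun x : Fin s → ℂ => ENNReal.ofReal
          (Real.exp (-t * ∑ j ∈ S i, ‖x j‖ ^ 2))) (by fun_prop),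
        lintegral_exp_mul_sum_normSq one_ne_zero (by simp; linarith), hS i]
      simp
    rw [lintegral_congr_ae this, lintegral_const, measure_univ, mul_one]
  unfold channelLaw
  rw [hact, ← Measure.prod_restrict, Measure.restrict_univ]
  have hm := lintegral_prod_mul
    (μ := (uniformOn {U : Finset (Fin u) | U.card = ku}).restrict {U | i ∈ U}) (ν := P₂)
    (f := fun _ => 1) (aemeasurable_const) hmeas.aemeasurable
  simp only [one_mul] at hm
  rw [hm, hinner, lintegral_const, one_mul, Measure.restrict_apply_univ, Measure.prod_prod,
    measure_univ, mul_one]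

instance (m n : ℕ) (σ : ℝ) : IsProbabilityMeasure (noiseLaw m n σ) := by
  unfold noiseLaw
  infer_instance

/-- Exponential Markov bound for the event that the energy of an active block is small compared
with the noise energy plus a constant. -/
theorem measure_block_le_noise (hu : ku ≤ u) (hs : ks ≤ s) (i : Fin u) {m n : ℕ} {σ b x t : ℝ}
    (hn : 1 ≤ n) (hσ : 0 < σ) (ht : 0 ≤ t) (htb : t * b * (σ ^ 2 / n) < 1) :
    ((channelLaw u s ku ks).prod (noiseLaw m n σ)) {p | p.1 ∈ activeSet i ∧
        ‖block (channelVec p.1) i‖ ^ 2 ≤ b * ∑ j, ‖p.2 j‖ ^ 2 + x}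
      ≤ channelLaw u s ku ks (activeSet i) *
        ENNReal.ofReal (Real.exp (t * x) * (1 + t)⁻¹ ^ ks * (1 - t * b * (σ ^ 2 / n))⁻¹ ^ m) := by
  have := isProbabilityMeasure_channelLaw hu hs
  have hn0 : (0 : ℝ) < n := by exact_mod_cast hn
  have hv0 : 0 < σ ^ 2 / n := by positivity
  have hv : Real.toNNReal (σ ^ 2 / n) ≠ 0 := by simpa using hv0
  have hvr : ((Real.toNNReal (σ ^ 2 / n) : NNReal) : ℝ) = σ ^ 2 / n := Real.coe_toNNReal _ hv0.le
  set F : Channel u s → ENNReal := (activeSet i).indicator fun c =>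
    ENNReal.ofReal (Real.exp (-t * ‖block (channelVec c) i‖ ^ 2)) with hF
  set G : (Fin m → ℂ) → ENNReal := fun z =>
    ENNReal.ofReal (Real.exp (t * b * ∑ j, ‖z j‖ ^ 2)) with hG
  have hFm : Measurable F := Measurable.indicator (ENNReal.measurable_ofReal.comp
    (Real.measurable_exp.comp ((measurable_normSq_block_channelVec i).const_mul _)))
    (measurableSet_activeSet i)
  have hGm : Measurable G := by fun_prop
  have hFi : ∫⁻ c, F c ∂(channelLaw u s ku ks)
      = channelLaw u s ku ks (activeSet i) * ENNReal.ofReal ((1 + t)⁻¹ ^ ks) := by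
    rw [hF, lintegral_indicator (measurableSet_activeSet i), lintegral_exp_neg_block hu hs i ht]
  have hGi : ∫⁻ z, G z ∂(noiseLaw m n σ)
      = ENNReal.ofReal ((1 - t * b * (σ ^ 2 / n))⁻¹ ^ m) := by
    rw [hG, noiseLaw, lintegral_exp_mul_sum_normSq hv (by rwa [hvr]), hvr]
    simp
  set ν := (channelLaw u s ku ks).prod (noiseLaw m n σ)
  -- On the event the exponent `t (x - ‖h_i‖² + b ‖z‖²)` is nonnegative; its exponential factors
  -- into independent functions of channel and noise.
  calc ν {p | p.1 ∈ activeSet i ∧ ‖block (channelVec p.1) i‖ ^ 2 ≤ b * ∑ j, ‖p.2 j‖ ^ 2 + x}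
      ≤ ν {p | 1 ≤ ENNReal.ofReal (Real.exp (t * x)) * (F p.1 * G p.2)} := by
        refine measure_mono ?_
        rintro ⟨c, z⟩ ⟨hc, h⟩
        simp only at hc h
        simp only [Set.mem_ofPred_eq, hF, hG, Set.indicator_of_mem hc]
        rw [← ENNReal.ofReal_mul (by positivity), ← ENNReal.ofReal_mul (by positivity),
          ← Real.exp_add, ← Real.exp_add, ← ENNReal.ofReal_one]
        refine ENNReal.ofReal_le_ofReal (Real.one_le_exp ?_)
        nlinarith [mul_le_mul_of_nonneg_left h ht]
    _ ≤ ∫⁻ p, ENNReal.ofReal (Real.exp (t * x)) * (F p.1 * G p.2) ∂ν := by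
        have := mul_meas_ge_le_lintegral (μ := ν)
          (f := fun p => ENNReal.ofReal (Real.exp (t * x)) * (F p.1 * G p.2))
          (by fun_prop) 1
        rwa [one_mul] at this
    _ = _ := by
        rw [lintegral_const_mul _ (by fun_prop),
          lintegral_prod_mul hFm.aemeasurable hGm.aemeasurable, hFi, hGi, mul_assoc,
          ← ENNReal.ofReal_mul (by positivity), mul_left_comm, ← ENNReal.ofReal_mul (by positivity),
          mul_assoc (Real.exp _)]

end Channel

/-! ### Comparison of the optimized exponential bound with `B₁`. -/

section Combinatorics

/-- Hockey-stick identity for the summands `(j + k).choose k`. -/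
theorem B₁_eq_choose (m k : ℕ) : B₁ (m + 1) (k + 1) = ((m + k + 1).choose (k + 1) : ℝ) := by
  rw [B₁, ← Nat.sum_range_add_choose, Nat.cast_sum]
  refine Finset.sum_congr rfl fun j _ => ?_
  rw [show (((k + 1 : ℕ) : ℝ) + j) = ((j + k : ℕ) : ℝ) + 1 by push_cast; ring,
    Real.Gamma_nat_eq_factorial, Nat.cast_add, Nat.cast_one, Real.Gamma_nat_eq_factorial,
    Nat.add_choose, Nat.cast_div (Nat.factorial_mul_factorial_dvd_factorial_add j k)
    (by positivity)]
  push_cast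
  rw [mul_comm (k.factorial : ℝ)]

theorem B₁_pos {m k : ℕ} (hm : 1 ≤ m) (hk : 1 ≤ k) : 0 < B₁ m k := by
  obtain ⟨m, rfl⟩ := Nat.exists_eq_add_of_le' hm
  obtain ⟨k, rfl⟩ := Nat.exists_eq_add_of_le' hk
  rw [B₁_eq_choose]
  exact_mod_cast Nat.choose_pos (by omega)

/-- The left side is what the optimal exponent leaves. Its second factor is at most `e ^ k` by `1 +
x ≤ exp x`; the first is comparable to the binomial coefficient. -/
theorem entropy_le_B₁ {m k : ℕ} (hm : 1 ≤ m) (hk : 1 ≤ k) :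
    (((m : ℝ) + k) / k) ^ k * (((m : ℝ) + k) / m) ^ m ≤ (2 * Real.exp 1) ^ k * B₁ m k := by
  have hm0 : (0 : ℝ) < m := by exact_mod_cast hm
  have hk0 : (0 : ℝ) < k := by exact_mod_cast hk
  have h1 : (((m : ℝ) + k) / m) ^ m ≤ Real.exp 1 ^ k := by
    have : ((m : ℝ) + k) / m ≤ Real.exp (k / m) := by
      have := Real.add_one_le_exp ((k : ℝ) / m)
      rwa [add_div, div_self hm0.ne', add_comm]
    calc (((m : ℝ) + k) / m) ^ m ≤ Real.exp (k / m) ^ m := by gcongr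
      _ = Real.exp 1 ^ k := by
        rw [← Real.exp_nat_mul, ← Real.exp_nat_mul]
        congr 1
        field_simp
  have h2 : (((m : ℝ) + k) / k) ^ k ≤ 2 ^ k * B₁ m k := by
    obtain ⟨m', rfl⟩ := Nat.exists_eq_add_of_le' hm
    obtain ⟨k', rfl⟩ := Nat.exists_eq_add_of_le' hk
    rw [B₁_eq_choose]
    -- For `m ≤ k` the base is at most `2`. Otherwise it is at most `2 m / k`, and `(m + k -
    -- 1).choose k ≥ m ^ k / k! ≥ (m / k) ^ k`.
    rcases le_total (m' + 1) (k' + 1) with h | h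
    · have hc : (1 : ℝ) ≤ ((m' + k' + 1).choose (k' + 1) : ℝ) := by
        exact_mod_cast Nat.choose_pos (by omega)
      have : (((m' + 1 : ℕ) : ℝ) + (k' + 1 : ℕ)) / (k' + 1 : ℕ) ≤ 2 := by
        rw [div_le_iff₀ hk0]
        have : ((m' + 1 : ℕ) : ℝ) ≤ (k' + 1 : ℕ) := by exact_mod_cast h
        linarith
      calc _ ≤ (2 : ℝ) ^ (k' + 1) := by gcongr
        _ ≤ _ := le_mul_of_one_le_right (by positivity) hc
    · have hc := Nat.pow_le_choose (α := ℝ) (k' + 1) (m' + k' + 1)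
      rw [show m' + k' + 1 + 1 - (k' + 1) = m' + 1 by omega] at hc
      have hf : ((k' + 1).factorial : ℝ) ≤ ((k' + 1 : ℕ) : ℝ) ^ (k' + 1) := by
        exact_mod_cast Nat.factorial_le_pow (k' + 1)
      have hc2 : (((m' + 1 : ℕ) : ℝ) / (k' + 1 : ℕ)) ^ (k' + 1) ≤
          ((m' + k' + 1).choose (k' + 1) : ℝ) := by
        refine le_trans ?_ hc
        rw [div_pow]
        gcongr
      have : (((m' + 1 : ℕ) : ℝ) + (k' + 1 : ℕ)) / (k' + 1 : ℕ)
          ≤ 2 * (((m' + 1 : ℕ) : ℝ) / (k' + 1 : ℕ)) := by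
        rw [← mul_div_assoc]
        gcongr
        have : ((k' + 1 : ℕ) : ℝ) ≤ (m' + 1 : ℕ) := by exact_mod_cast h
        linarith
      calc _ ≤ (2 * (((m' + 1 : ℕ) : ℝ) / (k' + 1 : ℕ))) ^ (k' + 1) := by gcongr
        _ = 2 ^ (k' + 1) * (((m' + 1 : ℕ) : ℝ) / (k' + 1 : ℕ)) ^ (k' + 1) := mul_pow _ _ _
        _ ≤ _ := by gcongr
  have h3 := (B₁_pos hm hk).le
  rw [mul_pow, mul_right_comm]
  gcongr

end Combinatorics

/-! ### Probability bounds for missed detection. -/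

section Bounds

variable {m u s ku ks n : ℕ}

theorem measure_block_le_B₁ (hu : ku ≤ u) (hs : ks ≤ s) (hks : 1 ≤ ks) (hm : 1 ≤ m) (hn : 1 ≤ n)
    (i : Fin u) {σ b : ℝ} (hσ : 0 < σ) (hb : 0 < b) :
    ((channelLaw u s ku ks).prod (noiseLaw m n σ)) {p | p.1 ∈ activeSet i ∧
        ‖block (channelVec p.1) i‖ ^ 2 ≤ b * ∑ j, ‖p.2 j‖ ^ 2}
      ≤ channelLaw u s ku ks (activeSet i) *
        ENNReal.ofReal ((2 * Real.exp 1 * b * (σ ^ 2 / n)) ^ ks * B₁ m ks) := by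
  have hn0 : (0 : ℝ) < n := by exact_mod_cast hn
  have hm0 : (0 : ℝ) < m := by exact_mod_cast hm
  have hk0 : (0 : ℝ) < ks := by exact_mod_cast hks
  set v := σ ^ 2 / n with hv
  have hv0 : 0 < v := by positivity
  -- With `θ = t b v`, and `t⁻¹` in place of `(1 + t)⁻¹`, the bound is a multiple of `θ ^ (-ks) (1 -
  -- θ) ^ (-m)`, which is minimal at this `θ`.
  set θ : ℝ := ks / (m + ks) with hθ
  have hθ0 : 0 < θ := by positivity
  have hθ1 : 1 - θ = m / (m + ks) := by
    rw [hθ]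
    field_simp
    ring
  have htb : θ / (b * v) * b * v = θ := by field_simp
  have hlt : θ < 1 := by
    have : 0 < (m : ℝ) / (m + ks) := by positivity
    linarith
  have h := measure_block_le_noise (m := m) (n := n) (x := 0) (t := θ / (b * v)) (b := b) hu hs i
    hn hσ (by positivity) (by rw [← hv, htb]; exact hlt)
  simp only [add_zero, mul_zero, Real.exp_zero, one_mul, ← hv, htb, hθ1, inv_div] at h
  refine h.trans (mul_le_mul_right (ENNReal.ofReal_le_ofReal ?_) _)
  have h1 : (1 + θ / (b * v))⁻¹ ≤ b * v * (((m : ℝ) + ks) / ks) := by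
    calc (1 + θ / (b * v))⁻¹ ≤ (θ / (b * v))⁻¹ := by gcongr; linarith
      _ = _ := by
        rw [hθ]
        field_simp
  calc (1 + θ / (b * v))⁻¹ ^ ks * (((m : ℝ) + ks) / m) ^ m
      ≤ (b * v * (((m : ℝ) + ks) / ks)) ^ ks * (((m : ℝ) + ks) / m) ^ m := by gcongr
    _ = (b * v) ^ ks * ((((m : ℝ) + ks) / ks) ^ ks * (((m : ℝ) + ks) / m) ^ m) := by
        rw [mul_pow (b * v), mul_assoc]
    _ ≤ (b * v) ^ ks * ((2 * Real.exp 1) ^ ks * B₁ m ks) := by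
        exact mul_le_mul_of_nonneg_left (entropy_le_B₁ hm hks) (by positivity)
    _ = _ := by
        rw [← mul_assoc, ← mul_pow]
        congr 2
        ring

/-- True also for `a = 0` and `a = ∞`, so conditioning needs no positivity of the activity
probability. -/
theorem ennreal_inv_mul_mul_le (a b : ENNReal) : a⁻¹ * (a * b) ≤ b := by
  rw [← mul_assoc, mul_comm a⁻¹ a]
  exact mul_le_of_le_one_left' (ENNReal.mul_inv_le_one a)

theorem blockCDF_le (hu : ku ≤ u) (hs : ks ≤ s) (i : Fin u) {x y : ℝ} (hx : 0 < x)
    (hy : y ≤ x) : blockCDF s ku ks i y ≤ Real.exp 1 * x ^ ks := by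
  have := isProbabilityMeasure_channelLaw hu hs
  refine ENNReal.toReal_le_of_le_ofReal (by positivity) ?_
  rw [cond_apply (measurableSet_activeSet i)]
  -- An empty noise vector reduces the bound to the block alone; `t = x⁻¹` makes the exponential
  -- factor `e`.
  have h := measure_block_le_noise (ku := ku) (m := 0) (n := 1) (σ := 1) (b := 0) (x := x)
    (t := x⁻¹) hu hs i le_rfl one_pos (by positivity) (by simp)
  have hset : {p : Channel u s × (Fin 0 → ℂ) | p.1 ∈ activeSet i ∧
      ‖block (channelVec p.1) i‖ ^ 2 ≤ 0 * ∑ j, ‖p.2 j‖ ^ 2 + x}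
      = (activeSet i ∩ {c | ‖block (channelVec c) i‖ ^ 2 ≤ x}) ×ˢ Set.univ := by
    ext p
    simp
  rw [hset, Measure.prod_prod, measure_univ, mul_one, pow_zero, mul_one,
    inv_mul_cancel₀ hx.ne'] at h
  calc _ ≤ (channelLaw u s ku ks (activeSet i))⁻¹ *
        (channelLaw u s ku ks (activeSet i) *
          ENNReal.ofReal (Real.exp 1 * (1 + x⁻¹)⁻¹ ^ ks)) := by
        gcongr
        refine le_trans (measure_mono ?_) h
        gcongr
    _ ≤ ENNReal.ofReal (Real.exp 1 * (1 + x⁻¹)⁻¹ ^ ks) := ennreal_inv_mul_mul_le _ _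
    _ ≤ _ := by
        gcongr
        rw [inv_le_comm₀ (by positivity) hx]
        linarith

theorem noiseLaw_singleton_zero (hm : 1 ≤ m) (hn : 1 ≤ n) {σ : ℝ} (hσ : 0 < σ) :
    noiseLaw m n σ {0} = 0 := by
  have hn0 : (0 : ℝ) < n := by exact_mod_cast hn
  have hv0 : 0 < σ ^ 2 / n := by positivity
  refine measure_mono_null (t := Function.eval (⟨0, hm⟩ : Fin m) ⁻¹' {0}) ?_
    (Measure.pi_eval_preimage_null _ (complexNormal_singleton_zero (by simpa using hv0)))
  rintro z rfl
  rfl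

/-- After sufficiently many iterations the transient error is dominated by the noise, outside an
event of small conditional probability. -/
theorem exists_iterations (hu : ku ≤ u) (hs : ks ≤ s) (hm : 1 ≤ m) (hn : 1 ≤ n) {σ r η : ℝ}
    (hσ : 0 < σ) (hr0 : 0 ≤ r) (hr1 : r < 1) (hη : 0 < η) :
    ∃ T : ℕ, ∀ i : Fin u, ((channelLaw u s ku ks).prod (noiseLaw m n σ))
      {p | p.1 ∈ activeSet i ∧ ∑ j, ‖p.2 j‖ ^ 2 < r ^ T * ‖channelVec p.1‖ ^ 2}
        ≤ channelLaw u s ku ks (activeSet i) * ENNReal.ofReal η := by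
  have := isProbabilityMeasure_channelLaw hu hs
  set ν := (channelLaw u s ku ks).prod (noiseLaw m n σ) with hν
  set E : ℕ → Set (Channel u s × (Fin m → ℂ)) := fun T =>
    {p | ∑ j, ‖p.2 j‖ ^ 2 < r ^ T * ‖channelVec p.1‖ ^ 2} with hE
  have hEm (T : ℕ) : MeasurableSet (E T) :=
    measurableSet_lt (by fun_prop) ((measurable_normSq_channelVec.comp measurable_fst).const_mul _)
  have hanti : Antitone E := by
    intro T T' hT p hp
    refine lt_of_lt_of_le (Set.mem_ofPred_eq ▸ hp) ?_
    gcongr ?_ * _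
    exact pow_le_pow_of_le_one hr0 hr1.le hT
  -- The channel is unbounded, so no `T` works for every realization. In the limit only zero noise
  -- remains, a null event.
  have hinter : ν (⋂ T, E T) = 0 := by
    refine measure_mono_null (t := Set.univ ×ˢ {0}) ?_ ?_
    · intro p hp
      have hp' (T : ℕ) : ∑ j, ‖p.2 j‖ ^ 2 ≤ r ^ T * ‖channelVec p.1‖ ^ 2 :=
        le_of_lt (Set.mem_iInter.1 hp T)
      have hlim : Filter.Tendsto (fun T : ℕ => r ^ T * ‖channelVec p.1‖ ^ 2) Filter.atTop
          (nhds 0) := by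
        simpa using (tendsto_pow_atTop_nhds_zero_of_lt_one hr0 hr1).mul_const _
      have h0 := ge_of_tendsto' hlim hp'
      refine ⟨trivial, ?_⟩
      have h1 := (Finset.sum_eq_zero_iff_of_nonneg (fun j _ => by positivity)).1
        (le_antisymm h0 (by positivity))
      ext j
      simpa using h1 j (Finset.mem_univ j)
    · rw [hν, Measure.prod_prod, noiseLaw_singleton_zero hm hn hσ, mul_zero]
  have hlim := tendsto_measure_iInter_atTop (μ := ν) (fun T => (hEm T).nullMeasurableSet) hanti
    ⟨0, measure_ne_top _ _⟩
  rw [hinter] at hlim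
  have hev : ∀ᶠ T in Filter.atTop, ∀ i : Fin u, ν
      {p | p.1 ∈ activeSet i ∧ ∑ j, ‖p.2 j‖ ^ 2 < r ^ T * ‖channelVec p.1‖ ^ 2}
        ≤ channelLaw u s ku ks (activeSet i) * ENNReal.ofReal η := by
    rw [Filter.eventually_all]
    intro i
    rcases eq_or_ne (channelLaw u s ku ks (activeSet i)) 0 with h0 | h0
    · refine .of_forall fun T => ?_
      rw [h0, zero_mul, nonpos_iff_eq_zero]
      refine measure_mono_null (t := activeSet i ×ˢ Set.univ) (fun p hp => ⟨hp.1, trivial⟩) ?_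
      rw [hν, Measure.prod_prod, h0, zero_mul]
    · have hpos : 0 < channelLaw u s ku ks (activeSet i) * ENNReal.ofReal η :=
        ENNReal.mul_pos h0 (by simpa using hη)
      filter_upwards [hlim.eventually (gt_mem_nhds hpos)] with T hT
      exact (measure_mono fun p hp => hp.2).trans hT.le
  exact hev.exists

theorem norm_block_sub_le (x y : Vec u s) (i : Fin u) : ‖block x i‖ ≤ ‖block y i‖ + ‖x - y‖ := by
  have h1 : block x i = block y i + block (x - y) i := by
    ext j
    simp [block]
  have h2 : ‖block (x - y) i‖ ≤ ‖x - y‖ := by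
    refine (sq_le_sq₀ (norm_nonneg _) (norm_nonneg _)).1 ?_
    rw [EuclideanSpace.norm_sq_eq, EuclideanSpace.norm_sq_eq, Fintype.sum_prod_type]
    exact Finset.single_le_sum (f := fun i' => ∑ j, ‖(x - y) (i', j)‖ ^ 2)
      (fun _ _ => by positivity) (Finset.mem_univ i)
  rw [h1]
  exact (norm_add_le _ _).trans (by gcongr)

/-- A missed block has small energy, compared with the threshold or with the error. -/
theorem normSq_block_le_of_notMem_detected {ξ : ℝ} (hξ : 0 ≤ ξ) {h hbar : Vec u s} {i : Fin u}
    (hi : i ∉ detected ξ hbar) :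
    ‖block h i‖ ^ 2 ≤ 4 * ξ ∨ ‖block h i‖ ^ 2 ≤ 4 * ‖h - hbar‖ ^ 2 := by
  have h1 := norm_block_sub_le h hbar i
  have h2 : ‖block hbar i‖ ≤ √ξ := by
    by_contra! hc
    refine hi ⟨hc.le, fun h0 => ?_⟩
    rw [h0, norm_zero] at hc
    exact absurd hc (not_lt.2 (Real.sqrt_nonneg _))
  have h3 := Real.sq_sqrt hξ
  -- The sum `√ξ + ‖h - hbar‖` is at most twice its larger term: hence the factor `4`, and two
  -- events to be bounded separately.
  rcases le_total (√ξ) ‖h - hbar‖ with hle | hle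
  · right
    have : ‖block h i‖ ≤ 2 * ‖h - hbar‖ := by linarith
    nlinarith [norm_nonneg (block h i)]
  · left
    have : ‖block h i‖ ≤ 2 * √ξ := by linarith
    nlinarith [norm_nonneg (block h i)]

/-- A union bound: the missed event is covered by products, in each of which the activity
probability factors out and cancels in the conditioning. Covering needs no measurability of the
detector. -/
theorem Pmd_le {r K δ σ ξ a b : ℝ} {T : ℕ} (hu : ku ≤ u) (hs : ks ≤ s) (ha : 0 ≤ a) (hb : 0 ≤ b)
    (hξ : 0 ≤ ξ) {alg : Algorithm}
    (hrec : ∀ (A : Mat m u s) (h hbar : Vec u s) (z : EuclideanSpace ℂ (Fin m)),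
      HiRIP (3 * ku) (3 * ks) δ A → HiSupp ku ks (support h) →
      alg.IsOutput ku ks T A (A.toEuclideanLin h + z) hbar →
      ‖h - hbar‖ ^ 2 ≤ r ^ T * ‖h‖ ^ 2 + K * ‖z‖ ^ 2)
    (μA : Measure (Mat m u s)) [IsProbabilityMeasure μA]
    (hbar : Mat m u s → EuclideanSpace ℂ (Fin m) → Vec u s)
    (hout : ∀ A y, alg.IsOutput ku ks T A y (hbar A y)) (i : Fin u)
    (hblock : ((channelLaw u s ku ks).prod (noiseLaw m n σ)) {p | p.1 ∈ activeSet i ∧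
        ‖block (channelVec p.1) i‖ ^ 2 ≤ 4 * (K + 1) * ∑ j, ‖p.2 j‖ ^ 2}
      ≤ channelLaw u s ku ks (activeSet i) * ENNReal.ofReal a)
    (htrans : ((channelLaw u s ku ks).prod (noiseLaw m n σ)) {p | p.1 ∈ activeSet i ∧
        ∑ j, ‖p.2 j‖ ^ 2 < r ^ T * ‖channelVec p.1‖ ^ 2}
      ≤ channelLaw u s ku ks (activeSet i) * ENNReal.ofReal b) :
    Pmd μA ku ks n σ ξ hbar i ≤ PnotRIP μA ku ks δ + blockCDF s ku ks i (4 * ξ) + a + b := by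
  have := isProbabilityMeasure_channelLaw hu hs
  set P := channelLaw u s ku ks with hP
  set ν := P.prod (noiseLaw m n σ) with hν
  set act : Set (Channel u s) := activeSet i with hact
  have hJ : jointLaw μA ku ks n σ = μA.prod ν := rfl
  have hactJ : {ω : Mat m u s × Channel u s × (Fin m → ℂ) | ω.2.1 ∈ act}
      = Set.univ ×ˢ (act ×ˢ Set.univ) := by
    ext ω
    simp
  have hmact : MeasurableSet {ω : Mat m u s × Channel u s × (Fin m → ℂ) | ω.2.1 ∈ act} :=
    (measurableSet_activeSet i).preimage (measurable_fst.comp measurable_snd)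
  set low : Set (Channel u s) := {c | ‖block (channelVec c) i‖ ^ 2 ≤ 4 * ξ} with hlow
  set Ea : Set (Channel u s × (Fin m → ℂ)) := {p | p.1 ∈ act ∧
    ‖block (channelVec p.1) i‖ ^ 2 ≤ 4 * (K + 1) * ∑ j, ‖p.2 j‖ ^ 2} with hEa
  set Eb : Set (Channel u s × (Fin m → ℂ)) := {p | p.1 ∈ act ∧
    ∑ j, ‖p.2 j‖ ^ 2 < r ^ T * ‖channelVec p.1‖ ^ 2} with hEb
  set bad : Set (Channel u s) := {c | ¬ HiSupp ku ks (support (channelVec c))} with hbad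
  set R : Set (Mat m u s) := {A | ¬ HiRIP (3 * ku) (3 * ks) δ A} with hR
  have hcover : {ω : Mat m u s × Channel u s × (Fin m → ℂ) | ω.2.1 ∈ act} ∩
      {ω | i ∉ detected ξ (hbar ω.1 (observe ω))} ⊆
      R ×ˢ (act ×ˢ Set.univ) ∪ Set.univ ×ˢ ((act ∩ low) ×ˢ Set.univ) ∪ Set.univ ×ˢ Ea
        ∪ Set.univ ×ˢ Eb ∪ Set.univ ×ˢ (bad ×ˢ Set.univ) := by
    rintro ⟨A, c, z⟩ ⟨hc, hmiss⟩
    have hc' : c ∈ act := hc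
    by_contra hcon
    simp only [Set.mem_union, Set.mem_prod, Set.mem_univ, true_and, and_true, Set.mem_inter_iff,
      hc', not_or, hR, hlow, hEa, hEb, hbad, Set.mem_ofPred_eq, not_not, not_lt] at hcon
    obtain ⟨⟨⟨⟨hA, h1⟩, h2⟩, h3⟩, h4⟩ := hcon
    have h5 := hrec A (channelVec c) _ (WithLp.toLp 2 z) hA h4 (hout A (observe (A, c, z)))
    rw [EuclideanSpace.norm_sq_eq (WithLp.toLp 2 z)] at h5
    rcases normSq_block_le_of_notMem_detected (h := channelVec c) hξ hmiss with h6 | h6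
    · exact h1 h6
    -- Off `Eb` the transient is at most the noise energy, which turns `K` into `K + 1`.
    · refine h2 (h6.trans ?_)
      simp only at h5 ⊢
      linarith
  have hbad0 : P bad = 0 := ae_iff.1 (ae_hiSupp_channelVec hu hs)
  have hπ : jointLaw μA ku ks n σ {ω | ω.2.1 ∈ act} = P act := by
    rw [hJ, hactJ, Measure.prod_prod, hν, Measure.prod_prod]
    simp
  have hmeas : jointLaw μA ku ks n σ ({ω | ω.2.1 ∈ act} ∩
      {ω | i ∉ detected ξ (hbar ω.1 (observe ω))}) ≤
      P act * μA R + P (act ∩ low) + P act * ENNReal.ofReal a + P act * ENNReal.ofReal b := by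
    refine (measure_mono hcover).trans ?_
    refine (measure_union_le _ _).trans ?_
    have e5 : jointLaw μA ku ks n σ (Set.univ ×ˢ (bad ×ˢ Set.univ)) = 0 := by
      rw [hJ, Measure.prod_prod, hν, Measure.prod_prod, hbad0]
      simp
    rw [e5, add_zero]
    refine (measure_union_le _ _).trans (add_le_add ?_ ?_)
    · refine (measure_union_le _ _).trans (add_le_add ?_ ?_)
      · refine (measure_union_le _ _).trans (add_le_add ?_ ?_)
        · rw [hJ, Measure.prod_prod, hν, Measure.prod_prod, measure_univ, mul_one, mul_comm]
        · rw [hJ, Measure.prod_prod, hν, Measure.prod_prod, measure_univ, measure_univ, mul_one,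
            one_mul]
      · rw [hJ, Measure.prod_prod, measure_univ, one_mul]
        exact hblock
    · rw [hJ, Measure.prod_prod, measure_univ, one_mul]
      exact htrans
  have hcond : (jointLaw μA ku ks n σ)[|{ω | ω.2.1 ∈ act}]
      {ω | i ∉ detected ξ (hbar ω.1 (observe ω))} ≤
      μA R + P[|act] low + ENNReal.ofReal a + ENNReal.ofReal b := by
    rw [cond_apply hmact, hπ, cond_apply (measurableSet_activeSet i)]
    calc _ ≤ (P act)⁻¹ * (P act * μA R + P (act ∩ low) + P act * ENNReal.ofReal a
          + P act * ENNReal.ofReal b) := by gcongr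
      _ = (P act)⁻¹ * (P act * μA R) + (P act)⁻¹ * P (act ∩ low)
          + (P act)⁻¹ * (P act * ENNReal.ofReal a) + (P act)⁻¹ * (P act * ENNReal.ofReal b) := by
        rw [mul_add, mul_add, mul_add]
      _ ≤ _ := by
        gcongr <;> exact ennreal_inv_mul_mul_le _ _
  have hfin := ENNReal.toReal_mono (by finiteness) hcond
  rw [ENNReal.toReal_add (by finiteness) (by finiteness),
    ENNReal.toReal_add (by finiteness) (by finiteness),
    ENNReal.toReal_add (by finiteness) (by finiteness), ENNReal.toReal_ofReal ha,
    ENNReal.toReal_ofReal hb] at hfin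
  exact hfin

/-- Without measurements `B₁` vanishes and the noise cannot dominate the transient; the claim
survives because the RIP fails surely, a unit coordinate vector being mapped to `0`. -/
theorem not_hiRIP_of_rows_eq_zero {δ : ℝ} (hδ : δ < 1) (hku : 1 ≤ ku) (hks : 1 ≤ ks) (i : Fin u)
    (j : Fin s) (A : Mat 0 u s) : ¬ HiRIP (3 * ku) (3 * ks) δ A := by
  intro hA
  set x : Vec u s := EuclideanSpace.single (i, j) (1 : ℂ) with hx
  have hsupp : support x ⊆ {(i, j)} := support_subset fun p hp => by
    simp [hx, Finset.notMem_singleton.1 hp]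
  have hS : HiSupp (3 * ku) (3 * ks) ({(i, j)} : Finset (Fin u × Fin s)) := by
    refine ⟨by simp; omega, fun i' => (Finset.card_filter_le _ _).trans ?_⟩
    rw [Finset.card_singleton]
    omega
  have h := (hA x (hiSparse_iff.2 (hS.mono hsupp))).1
  rw [Subsingleton.elim (A.toEuclideanLin x) 0, norm_zero, hx, PiLp.norm_single] at h
  norm_num at h
  linarith

end Bounds

end HiDetect

/-! ### Choice of the constants and conclusion. -/

theorem theorem2 (δ : ℝ) (hδ0 : 0 ≤ δ) (hδ : δ < 1 / √3) :
    ∃ τ : ℝ, 0 < τ ∧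
      ∀ (u s ku ks m n : ℕ), 1 ≤ ku → ku ≤ u → 1 ≤ ks → ks ≤ s → 1 ≤ n →
      ∀ c : ℝ, 0 ≤ c → ∃ C : ℝ,
      ∀ σ : ℝ, 0 < σ → ∃ T : ℕ,
      ∀ (μA : MeasureTheory.Measure (HiDetect.Mat m u s)) [MeasureTheory.IsProbabilityMeasure μA]
        (alg : HiDetect.Algorithm)
        (hbar : HiDetect.Mat m u s → EuclideanSpace ℂ (Fin m) → HiDetect.Vec u s),
        (∀ A y, alg.IsOutput ku ks T A y (hbar A y)) →
      ∀ (ξ : ℝ), 0 ≤ ξ → ∀ i : Fin u,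
        HiDetect.Pmd μA ku ks n σ ξ hbar i ≤
            HiDetect.PnotRIP μA ku ks δ
              + HiDetect.blockCDF s ku ks i (4 * ξ)
              + (4 * τ ^ 2) ^ ks * (n : ℝ) ^ (-(ks : ℤ)) * HiDetect.SNR σ ^ (-(ks : ℤ))
                * HiDetect.B₁ m ks ∧
        (ξ ≤ c / HiDetect.SNR σ →
          HiDetect.Pmd μA ku ks n σ ξ hbar i ≤
            HiDetect.PnotRIP μA ku ks δ + C * HiDetect.SNR σ ^ (-(ks : ℤ))) := by
  obtain ⟨r, K, hr0, hr1, hK, hrec⟩ := HiDetect.exists_recovery_constants hδ0 hδ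
  -- Chosen so that `4 τ²` is twice the constant `2 e · 4 (K + 1)` of the block bound; the spare
  -- factor pays for the transient.
  set τ := √(4 * Real.exp 1 * (K + 1)) with hτ
  have hτ2 : τ ^ 2 = 4 * Real.exp 1 * (K + 1) := Real.sq_sqrt (by positivity)
  refine ⟨τ, by positivity, fun u s ku ks m n hku hu hks hs hn c hc => ?_⟩
  have hn0 : (0 : ℝ) < n := by exact_mod_cast hn
  -- The first summand is the bound on `F` at `4 (c + 1) σ²`; `c + 1` keeps this positive for `c =
  -- 0`.
  refine ⟨Real.exp 1 * (4 * (c + 1)) ^ ks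
    + (4 * τ ^ 2) ^ ks * (n : ℝ) ^ (-(ks : ℤ)) * HiDetect.B₁ m ks, fun σ hσ => ?_⟩
  have hSNR : HiDetect.SNR σ ^ (-(ks : ℤ)) = (σ ^ 2) ^ ks := by
    rw [HiDetect.SNR, zpow_neg, zpow_natCast, one_div, inv_pow, inv_inv]
  have hn1 : (n : ℝ) ^ (-(ks : ℤ)) = (n : ℝ)⁻¹ ^ ks := by
    rw [zpow_neg, zpow_natCast, inv_pow]
  rw [hSNR, hn1]
  rcases Nat.eq_zero_or_pos m with rfl | hm
  · refine ⟨0, fun μA _ alg hbar _ ξ _ i => ?_⟩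
    have hδ1 : δ < 1 := hδ.trans_le (by
      rw [div_le_one (by positivity)]
      exact Real.one_le_sqrt.2 (by norm_num))
    have hR : HiDetect.PnotRIP μA ku ks δ = 1 := by
      have : {A : HiDetect.Mat 0 u s | ¬ HiDetect.HiRIP (3 * ku) (3 * ks) δ A} = Set.univ :=
        Set.eq_univ_of_forall
          (HiDetect.not_hiRIP_of_rows_eq_zero hδ1 hku hks i ⟨0, hks.trans hs⟩)
      rw [HiDetect.PnotRIP, this]
      simp
    have hP : HiDetect.Pmd μA ku ks n σ ξ hbar i ≤ 1 := measureReal_le_one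
    have hB : HiDetect.B₁ 0 ks = 0 := by simp [HiDetect.B₁]
    have hF : 0 ≤ HiDetect.blockCDF s ku ks i (4 * ξ) := measureReal_nonneg
    rw [hR, hB, mul_zero, mul_zero, add_zero, add_zero]
    refine ⟨by linarith, fun _ => hP.trans (le_add_of_nonneg_right (by positivity))⟩
  · have hB := HiDetect.B₁_pos hm hks
    set Q := (4 * τ ^ 2) ^ ks * (n : ℝ)⁻¹ ^ ks * (σ ^ 2) ^ ks * HiDetect.B₁ m ks with hQ
    have hQ0 : 0 < Q := by positivity
    obtain ⟨T, hT⟩ := HiDetect.exists_iterations (ku := ku) (ks := ks) (s := s) hu hs hm hn hσ hr0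
      hr1 (half_pos hQ0)
    refine ⟨T, fun μA _ alg hbar hout ξ hξ i => ?_⟩
    -- The spare factor `2 ^ (-ks)` is at most `1/2` as `ks ≥ 1`, leaving `Q / 2` for the transient
    -- event.
    have hle : (2 * Real.exp 1 * (4 * (K + 1)) * (σ ^ 2 / n)) ^ ks * HiDetect.B₁ m ks ≤ Q / 2 := by
      have e : 2 * Real.exp 1 * (4 * (K + 1)) * (σ ^ 2 / n)
          = 4 * τ ^ 2 * (n : ℝ)⁻¹ * σ ^ 2 * (1 / 2) := by
        rw [hτ2]
        ring
      have h2 : (1 / 2 : ℝ) ^ ks ≤ 1 / 2 :=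
        pow_le_of_le_one (by norm_num) (by norm_num) (by omega)
      rw [e, mul_pow, mul_pow, mul_pow, hQ]
      calc _ ≤ (4 * τ ^ 2) ^ ks * (n : ℝ)⁻¹ ^ ks * (σ ^ 2) ^ ks * (1 / 2) * HiDetect.B₁ m ks := by
            gcongr
        _ = _ := by ring
    have hblock := (HiDetect.measure_block_le_B₁ (ku := ku) hu hs hks hm hn i hσ
      (by positivity : 0 < 4 * (K + 1))).trans
        (mul_le_mul_right (ENNReal.ofReal_le_ofReal hle) _)
    have hmain := HiDetect.Pmd_le hu hs (half_pos hQ0).le (half_pos hQ0).le hξ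
      (hrec ku ks T alg) μA hbar hout i hblock (hT i)
    refine ⟨by linarith, fun hξc => ?_⟩
    have hx : 4 * ξ ≤ 4 * (c + 1) * σ ^ 2 := by
      rw [HiDetect.SNR, div_div_eq_mul_div, div_one] at hξc
      nlinarith [sq_nonneg σ]
    have hF := HiDetect.blockCDF_le (ku := ku) hu hs i (by positivity) hx
    rw [mul_pow] at hF
    have : (Real.exp 1 * (4 * (c + 1)) ^ ks
        + (4 * τ ^ 2) ^ ks * (n : ℝ)⁻¹ ^ ks * HiDetect.B₁ m ks) * (σ ^ 2) ^ ks
        = Real.exp 1 * ((4 * (c + 1)) ^ ks * (σ ^ 2) ^ ks) + Q := by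
      rw [hQ]
      ring
    rw [this]
    linarith
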